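/- Call a set of finitely many disks of positive radius in the plane a disjoint bubble set for a finite point set $P\subset\mathbb{R}^2$ if no disk contains a point of $P$ in its interior, any two distinct disks of the set have disjoint interiors (they may touch), and every point of $P$ lies on the boundary of at least one of the disks. Let $D(P)$ be the minimum number of disks in a disjoint bubble set for $P$, and let $D(n)$ be the maximum of $D(P)$ over all $n$-element point sets $P\subset\mathbb{R}^2$. Then $$D(n)\ \ge\ \frac n2+\frac n{236}-O(\sqrt n)\qquad\text{for every } n;$$ that is, there is an absolute constant $C$ such that $D(n)\ge \frac n2+\frac n{236}-C\sqrt n$ for every integer $n\ge 0$. -/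

import Mathlib

/-- The Euclidean plane. -/
abbrev Plane : Type := EuclideanSpace ℝ (Fin 2)

/-- A (round, nondegenerate) disk in the Euclidean plane, given by its centre and radius. -/
structure Disk where
  center : Plane
  radius : ℝ
  radius_pos : 0 < radius

/-- The open disk. -/
def Disk.interior (Q : Disk) : Set Plane := Metric.ball Q.center Q.radius

/-- The bounding circle. -/
def Disk.boundary (Q : Disk) : Set Plane := Metric.sphere Q.center Q.radius

/-- `Q` is empty with respect to `P`: no point of `P` lies in the interior of `Q`
(points of `P` on the boundary are allowed). -/
def Disk.IsEmptyFor (Q : Disk) (P : Finset Plane) : Prop :=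
  ∀ p ∈ P, p ∉ Q.interior

/-- A disjoint bubble set for `P`: a finite set of empty disks, any two of which are disjoint
in the sense that their interiors do not meet (they may touch), such that every point of `P`
lies on the boundary of at least one of them. -/
structure IsDisjointBubbleSet (P : Finset Plane) (𝒬 : Finset Disk) : Prop where
  empty : ∀ Q ∈ 𝒬, Q.IsEmptyFor P
  disjoint : ∀ Q ∈ 𝒬, ∀ Q' ∈ 𝒬, Q ≠ Q' → Disjoint Q.interior Q'.interior
  supported : ∀ p ∈ P, ∃ Q ∈ 𝒬, p ∈ Q.boundary

/-- `D(P)`: the minimum number of disks in a disjoint bubble set for `P`. -/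
noncomputable def disjointBubbleNumberOf (P : Finset Plane) : ℕ :=
  sInf {m : ℕ | ∃ 𝒬 : Finset Disk, IsDisjointBubbleSet P 𝒬 ∧ 𝒬.card = m}

/-- `D(n)`: the maximum of `D(P)` over all sets `P` of `n` points in the plane. -/
noncomputable def disjointBubbleNumber (n : ℕ) : ℕ :=
  sSup {m : ℕ | ∃ P : Finset Plane, P.card = n ∧ disjointBubbleNumberOf P = m}

/-- Every finite point set has a disjoint bubble set with at most one disk per point, so the
minimum in `disjointBubbleNumberOf` is taken over a nonempty set. -/
theorem exists_isDisjointBubbleSet (P : Finset Plane) :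
    ∃ 𝒬 : Finset Disk, IsDisjointBubbleSet P 𝒬 ∧ 𝒬.card ≤ P.card := by
  classical
  obtain ⟨ε, hε, hsep⟩ : ∃ ε : ℝ, 0 < ε ∧ ∀ p ∈ P, ∀ q ∈ P, p ≠ q → 4 * ε ≤ dist p q := by
    by_cases h : (P : Set Plane).Nontrivial
    · have hpos := P.finite_toSet.infsep_pos_iff_nontrivial.2 h
      refine ⟨(P : Set Plane).infsep / 4, by positivity, fun p hp q hq hpq => ?_⟩
      have := Set.infsep_le_dist_of_mem (s := (P : Set Plane)) hp hq hpq
      linarith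
    · exact ⟨1, one_pos, fun p hp q hq hpq => (h ⟨p, hp, q, hq, hpq⟩).elim⟩
  let v : Plane := EuclideanSpace.single 0 ε
  have hv : ‖v‖ = ε := by simp [v, abs_of_pos hε]
  let F : Plane → Disk := fun p => ⟨p + v, ε, hε⟩
  have key : ∀ p x : Plane, x ∈ (F p).interior → dist x p < 2 * ε := by
    intro p x hx
    have h1 : dist x (p + v) < ε := hx
    have h2 : dist (p + v) p = ε := by simp [hv]
    linarith [dist_triangle x (p + v) p]
  refine ⟨P.image F, ⟨?_, ?_, ?_⟩, Finset.card_image_le⟩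
  · simp only [Finset.mem_image]
    rintro _ ⟨p, hp, rfl⟩ q hq hmem
    rcases eq_or_ne q p with rfl | hne
    · have h1 : dist q (q + v) < ε := hmem
      simp [hv] at h1
    · linarith [key p q hmem, hsep q hq p hp hne]
  · simp only [Finset.mem_image]
    rintro _ ⟨p, hp, rfl⟩ _ ⟨q, hq, rfl⟩ hne
    have hpq : p ≠ q := fun h => hne (by rw [h])
    rw [Set.disjoint_left]
    intro x hx hx'
    linarith [key p x hx, key q x hx', hsep p hp q hq hpq, dist_triangle_left p q x]
  · intro p hp
    refine ⟨F p, Finset.mem_image_of_mem _ hp, ?_⟩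
    change dist p (p + v) = ε
    simp [hv]

/-- `D(P) ≤ |P|`. -/
theorem disjointBubbleNumberOf_le_card (P : Finset Plane) :
    disjointBubbleNumberOf P ≤ P.card := by
  obtain ⟨𝒬, h𝒬, hcard⟩ := exists_isDisjointBubbleSet P
  have h : disjointBubbleNumberOf P ≤ 𝒬.card := Nat.sInf_le ⟨𝒬, h𝒬, rfl⟩
  exact h.trans hcard

/-- The set over which the maximum in `disjointBubbleNumber` is taken is nonempty. -/
theorem nonempty_disjointBubbleNumberOf (n : ℕ) :
    {m : ℕ | ∃ P : Finset Plane, P.card = n ∧ disjointBubbleNumberOf P = m}.Nonempty := by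
  obtain ⟨P, hP⟩ := Infinite.exists_subset_card_eq Plane n
  exact ⟨_, P, hP, rfl⟩

/-- The set over which the maximum in `disjointBubbleNumber` is taken is bounded. -/
theorem bddAbove_disjointBubbleNumberOf (n : ℕ) :
    BddAbove {m : ℕ | ∃ P : Finset Plane, P.card = n ∧ disjointBubbleNumberOf P = m} := by
  use n
  rintro _ ⟨P, rfl, rfl⟩
  exact disjointBubbleNumberOf_le_card P

/-! The extremal configuration consists of far-apart wheels, each a regular 235-gon with its centre.
A wheel has 236 points and forces 119 = 236/2 + 1 disks of radius below 1000. Such a disk cannot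
serve two wheels, so the counts add up; leftover points cost only a bounded amount.

For one wheel, some disk D touches the centre. An empty disk touches at most two vertices, and two
only if they are neighbours. If neither D nor any disk of radius at least 1000 touched a vertex, the
odd number 235 would force 118 small disks besides D. The work lies in showing that these
exceptional "contact disks" save nothing. Call an untouched vertex single if its chosen disk is
chosen by no other untouched vertex. Double counting gives 2·(other small disks) ≥ 235 − (vertices
touched by contact disks) + (single vertices), so it suffices that single vertices are at least as
many as touched ones (`card_touched_le_card_single`).

The geometry behind this uses Lorentz coordinates of circles, in which separation is bilinear,
touching a vertex is linear, and inversion in the unit circle is a sign change. Inversion takes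
disks through the centre to half-planes, which disks of huge radius approximate, so inner and outer
contact disks are treated alike. A contact disk tilts every disk on a nearby edge strongly to the
opposite side of the polygon. Hence two such disks close together on the same side of it overlap
(`no_two_pairs_inner`), which produces a single vertex on each side. Where an inner and an outer
contact disk are close, no edge disk fits at all (`no_pair_between`). Two outer ones are never close
(`no_two_large`). -/

section

/-! ### Numerical bounds for the half step angle. -/

open Real

/-- Half of the angle between neighbouring vertices of the regular 235-gon. -/
noncomputable def halfStep : ℝ := π / 235

theorem halfStep_gt : 0.013368 < halfStep := by
  unfold halfStep; rw [lt_div_iff₀ (by norm_num)]; linarith [Real.pi_gt_d4]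

theorem halfStep_lt : halfStep < 0.013369 := by
  unfold halfStep; rw [div_lt_iff₀ (by norm_num)]; linarith [Real.pi_lt_d4]

theorem halfStep_pos : 0 < halfStep := by linarith [halfStep_gt]

theorem sin_halfStep_gt : 0.013366 < sin halfStep := by
  have h1 := halfStep_gt
  have h2 := halfStep_lt
  have h3 := Real.sin_gt_sub_cube halfStep_pos
  have h4 : halfStep ^ 3 ≤ 0.013369 ^ 3 := by gcongr
  norm_num at h4 ⊢
  linarith

theorem sin_halfStep_lt : sin halfStep < 0.013369 :=
  (Real.sin_lt halfStep_pos).trans halfStep_lt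

theorem sin_halfStep_pos : 0 < sin halfStep := by linarith [sin_halfStep_gt]

theorem cos_halfStep_gt : 0.9999 < cos halfStep := by
  have h4 : halfStep ^ 2 ≤ 0.013369 ^ 2 := by
    gcongr
    · exact halfStep_pos.le
    · exact halfStep_lt.le
  have := Real.one_sub_sq_div_two_le_cos (x := halfStep)
  norm_num at h4 ⊢
  linarith

/-- The distance, in steps rounded up, between the edge `(m, m + 1)` and the vertex `0`. -/
def edgeOffset (m : ℤ) : ℤ := if 0 ≤ m then m + 1 else -m

theorem edgeOffset_pos (m : ℤ) : 1 ≤ edgeOffset m := by unfold edgeOffset; split_ifs <;> omega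

theorem abs_edge (m : ℤ) : |2 * (m : ℝ) + 1| = 2 * (edgeOffset m : ℝ) - 1 := by
  unfold edgeOffset
  split_ifs with h
  · have : (0 : ℝ) ≤ m := by exact_mod_cast h
    rw [abs_of_nonneg (by linarith)]; push_cast; ring
  · have : (m : ℝ) ≤ -1 := by exact_mod_cast (by omega : m ≤ -1)
    rw [abs_of_nonpos (by linarith)]; push_cast; ring

/-! ### Circles in Lorentz coordinates and their contact with vertices. -/

/-- A disk in coordinates adapted to the unit circle: for a disk with centre `c`, radius `r` and
power of the origin `s = |c|² - r²` these are `(x, y) = c / r`, `a = (s + 1) / (2 r)` and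
`b = (s - 1) / (2 r)`. The disk contains no vertex of the regular 235-gon. The inversion in the
unit circle amounts to the change of sign of `b`. -/
structure NormDisk where
  x : ℝ
  y : ℝ
  a : ℝ
  b : ℝ
  quad : x ^ 2 + y ^ 2 = 1 + a ^ 2 - b ^ 2
  le_a : b ≤ a
  neg_le_a : -b ≤ a
  empty : ∀ k : ℤ, x * cos (2 * halfStep * k) + y * sin (2 * halfStep * k) ≤ a

namespace NormDisk

/-- The disk touches the vertex with index `k`. -/
def Touch (A : NormDisk) (k : ℤ) : Prop :=
  A.x * cos (2 * halfStep * k) + A.y * sin (2 * halfStep * k) = A.a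

/-- The condition that the interiors of two disks are disjoint. -/
def Sep (A E : NormDisk) : Prop := 1 ≤ A.a * E.a - A.b * E.b - A.x * E.x - A.y * E.y

/-- The image under the inversion in the unit circle. -/
def flip (A : NormDisk) : NormDisk where
  x := A.x
  y := A.y
  a := A.a
  b := -A.b
  quad := by rw [A.quad]; ring
  le_a := A.neg_le_a
  neg_le_a := by rw [neg_neg]; exact A.le_a
  empty := A.empty

theorem Sep.flip {A E : NormDisk} (h : A.Sep E) : A.flip.Sep E.flip := by
  unfold Sep NormDisk.flip at *; simpa using h

theorem Touch.flip {A : NormDisk} {k : ℤ} (h : A.Touch k) : A.flip.Touch k := h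

/-- The tangential component of the centre at the vertex `k`. -/
noncomputable def tau (A : NormDisk) (k : ℤ) : ℝ :=
  -A.x * sin (2 * halfStep * k) + A.y * cos (2 * halfStep * k)

theorem a_nonneg (A : NormDisk) : 0 ≤ A.a := by linarith [A.le_a, A.neg_le_a]

theorem Touch.apply_add {A : NormDisk} {k : ℤ} (h : A.Touch k) (t : ℝ) :
    A.x * cos (2 * halfStep * k + t) + A.y * sin (2 * halfStep * k + t) =
      A.a * cos t + A.tau k * sin t := by
  unfold Touch at h
  rw [← h, cos_add, sin_add, tau]; ring

theorem Touch.apply_tangent {A : NormDisk} {k : ℤ} (h : A.Touch k) (t : ℝ) :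
    -A.x * sin (2 * halfStep * k + t) + A.y * cos (2 * halfStep * k + t) =
      A.tau k * cos t - A.a * sin t := by
  unfold Touch at h
  rw [← h, cos_add, sin_add, tau]; ring

/-- In the radial and tangential frame at the touched vertex, the vector `(x, y)` has components `a`
and `tau`. Geometrically `b` and `tau` are the cosine and, up to sign, the sine of the angle between
the outward normal of the unit circle at the vertex and the direction from there to the centre of
the disk. -/
theorem Touch.sq_tau {A : NormDisk} {k : ℤ} (h : A.Touch k) : A.tau k ^ 2 = 1 - A.b ^ 2 := by
  have h1 := A.quad
  have h2 := sin_sq_add_cos_sq (2 * halfStep * k)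
  have h3 : A.a ^ 2 + A.tau k ^ 2 = A.x ^ 2 + A.y ^ 2 := by
    unfold Touch at h
    rw [← h, tau]
    linear_combination (A.x ^ 2 + A.y ^ 2) * h2
  linarith

/-- Emptiness at the two neighbouring vertices bounds the tangential component from both sides: a
disk tilted further would swallow a neighbour. -/
theorem Touch.abs_tau_mul_cos_le {A : NormDisk} {k : ℤ} (h : A.Touch k) :
    |A.tau k| * cos halfStep ≤ A.a * sin halfStep := by
  have hs := sin_halfStep_pos
  have e1 := A.empty (k + 1)
  have e2 := A.empty (k - 1)
  have c1 : 2 * halfStep * ((k + 1 : ℤ) : ℝ) = 2 * halfStep * k + 2 * halfStep := by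
    push_cast; ring
  have c2 : 2 * halfStep * ((k - 1 : ℤ) : ℝ) = 2 * halfStep * k + -(2 * halfStep) := by
    push_cast; ring
  rw [c1, h.apply_add] at e1
  rw [c2, h.apply_add] at e2
  have hc := sin_sq_add_cos_sq halfStep
  rw [cos_two_mul, sin_two_mul] at e1
  rw [cos_neg, sin_neg, cos_two_mul, sin_two_mul] at e2
  have f1 : sin halfStep * (A.tau k * cos halfStep) ≤ sin halfStep * (A.a * sin halfStep) := by
    have : cos halfStep ^ 2 = 1 - sin halfStep ^ 2 := by linarith
    rw [this] at e1; nlinarith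
  have f2 : sin halfStep * (-A.tau k * cos halfStep) ≤ sin halfStep * (A.a * sin halfStep) := by
    have : cos halfStep ^ 2 = 1 - sin halfStep ^ 2 := by linarith
    rw [this] at e2; nlinarith
  have g1 := le_of_mul_le_mul_left f1 hs
  have g2 := le_of_mul_le_mul_left f2 hs
  rcases abs_cases (A.tau k) with ⟨h, _⟩ | ⟨h, _⟩ <;> rw [h] <;> assumption

theorem Touch.abs_tau_le {A : NormDisk} {k : ℤ} (h : A.Touch k) :
    |A.tau k| ≤ 0.0134 * A.a := by
  have h1 := h.abs_tau_mul_cos_le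
  have h2 := cos_halfStep_gt
  have h3 := sin_halfStep_lt
  have h4 := A.a_nonneg
  have h5 := abs_nonneg (A.tau k)
  have h6 : |A.tau k| * 0.9999 ≤ A.a * 0.013369 := by
    calc |A.tau k| * 0.9999 ≤ |A.tau k| * cos halfStep := by gcongr
      _ ≤ A.a * sin halfStep := h1
      _ ≤ _ := by gcongr
  linarith

theorem Touch.b_sq_le {A : NormDisk} {k : ℤ} (h : A.Touch k) : A.b ^ 2 ≤ 1 := by
  nlinarith [h.sq_tau, sq_nonneg (A.tau k)]

theorem Touch.a_pos {A : NormDisk} {k : ℤ} (h : A.Touch k) : 0 < A.a := by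
  rcases A.a_nonneg.lt_or_eq with h0 | h0
  · exact h0
  · have h1 := h.abs_tau_le
    have hb : A.b = 0 := by linarith [A.le_a, A.neg_le_a]
    have ht : A.tau k = 0 := by
      rw [← h0, mul_zero] at h1
      exact abs_eq_zero.1 (le_antisymm h1 (abs_nonneg _))
    have := h.sq_tau
    rw [hb, ht] at this
    norm_num at this

/-- If a disk touches two vertices, these are neighbours or equal. -/
theorem Touch.adjacent {A : NormDisk} {k : ℤ} {d : ℤ} (h : A.Touch k) (h' : A.Touch (k + d))
    (h0 : 0 ≤ d) (h1 : d < 235) : d = 0 ∨ d = 1 ∨ d = 234 := by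
  by_contra hcon
  push Not at hcon
  obtain ⟨n0, n1, n2⟩ := hcon
  have hd2 : (2 : ℝ) ≤ d := by exact_mod_cast (by omega : (2 : ℤ) ≤ d)
  have hd3 : (d : ℝ) ≤ 233 := by exact_mod_cast (by omega : d ≤ (233 : ℤ))
  have hpos := halfStep_pos
  have hpi : π = 235 * halfStep := by unfold halfStep; ring
  have hlt : sin halfStep < sin (d * halfStep) := by
    have e := sin_sub_sin (d * halfStep) halfStep
    have e1 : 0 < sin ((d * halfStep - halfStep) / 2) := by
      apply sin_pos_of_pos_of_lt_pi <;> nlinarith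
    have e2 : 0 < cos ((d * halfStep + halfStep) / 2) := by
      apply cos_pos_of_mem_Ioo
      constructor <;> nlinarith
    have : 0 < 2 * sin ((d * halfStep - halfStep) / 2) * cos ((d * halfStep + halfStep) / 2) := by
      positivity
    linarith
  have hs := sin_halfStep_pos
  have c1 : 2 * halfStep * ((k + d : ℤ) : ℝ) = 2 * halfStep * k + 2 * (d * halfStep) := by
    push_cast; ring
  unfold Touch at h'
  rw [c1, h.apply_add, cos_two_mul, sin_two_mul] at h'
  have hc := sin_sq_add_cos_sq (d * halfStep)
  have hch := sin_sq_add_cos_sq halfStep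
  set S := sin (d * halfStep)
  set C := cos (d * halfStep)
  have hS : 0 < S := hs.trans hlt
  -- Contact at the second vertex means tau / a = tan(d · `halfStep`), whereas emptiness gives |tau
  -- / a| ≤ tan `halfStep`.
  have e1 : A.a * S = A.tau k * C := by
    have : S * (A.a * S) = S * (A.tau k * C) := by linear_combination A.a * hc - h' / 2
    exact mul_left_cancel₀ hS.ne' this
  have e2 := h.abs_tau_mul_cos_le
  have hcos : 0 < cos halfStep := by linarith [cos_halfStep_gt]
  have e3 : A.a * (S * cos halfStep) ≤ A.a * (sin halfStep * |C|) := by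
    calc A.a * (S * cos halfStep) = (A.tau k * C) * cos halfStep := by rw [← e1]; ring
      _ ≤ |A.tau k * C| * cos halfStep := by gcongr; exact le_abs_self _
      _ = (|A.tau k| * cos halfStep) * |C| := by rw [abs_mul]; ring
      _ ≤ (A.a * sin halfStep) * |C| := by gcongr
      _ = _ := by ring
  have e4 := le_of_mul_le_mul_left e3 h.a_pos
  have e5 : (S * cos halfStep) ^ 2 ≤ (sin halfStep * |C|) ^ 2 := by gcongr
  rw [mul_pow, mul_pow, sq_abs] at e5
  nlinarith

theorem touch_add_period {A : NormDisk} {k : ℤ} (m : ℤ) : A.Touch (k + 235 * m) ↔ A.Touch k := by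
  have : 2 * halfStep * ((k + 235 * m : ℤ) : ℝ) = 2 * halfStep * k + m * (2 * π) := by
    unfold halfStep; push_cast; ring
  unfold Touch
  rw [this, cos_add_int_mul_two_pi, sin_add_int_mul_two_pi]

theorem Touch.b_bounds {A : NormDisk} {k : ℤ} (h : A.Touch k) : A.b ≤ 1 ∧ -1 ≤ A.b := by
  have := h.b_sq_le
  constructor <;> nlinarith

/-! ### Edge disks: disks touching two neighbouring vertices. -/

/-- The half-length of the chord that a disk cuts from the unit circle, suitably scaled. -/
noncomputable def w (A : NormDisk) : ℝ := √(1 - A.b ^ 2)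

/-- By symmetry the centre lies on the axis of the edge, so edge disks form a one-parameter family.
Writing b = cos θ, `w` is sin θ, and bounds on (1 ∓ b) / w are bounds on tan(θ/2) or its reciprocal.
-/
theorem exists_of_touch_touch {A : NormDisk} {l : ℤ} (h : A.Touch l) (h' : A.Touch (l + 1)) :
    ∃ g, 0 < g ∧ A.x = g * cos (2 * halfStep * l + halfStep) ∧
      A.y = g * sin (2 * halfStep * l + halfStep) ∧ A.a = g * cos halfStep ∧
      A.w = g * sin halfStep ∧ A.w ^ 2 = 1 - A.b ^ 2 := by
  have hs := sin_halfStep_pos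
  have hcos : 0 < cos halfStep := by linarith [cos_halfStep_gt]
  have hc := sin_sq_add_cos_sq halfStep
  have hcl := sin_sq_add_cos_sq (2 * halfStep * l + halfStep)
  have c1 : 2 * halfStep * ((l + 1 : ℤ) : ℝ) = 2 * halfStep * l + 2 * halfStep := by
    push_cast; ring
  have h2 := h'
  unfold Touch at h2
  rw [c1, h.apply_add, cos_two_mul, sin_two_mul] at h2
  have e1 : A.tau l * cos halfStep = A.a * sin halfStep := by
    apply mul_left_cancel₀ hs.ne'
    linear_combination h2 / 2 - A.a * hc
  have p1 := h.apply_add halfStep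
  have p2 := h.apply_tangent halfStep
  have q0 : A.tau l * cos halfStep - A.a * sin halfStep = 0 := by linarith
  rw [q0] at p2
  set φ := 2 * halfStep * l + halfStep
  set g := A.a * cos halfStep + A.tau l * sin halfStep with hg
  have ha : A.a = g * cos halfStep := by rw [hg]; linear_combination -A.a * hc - sin halfStep * e1
  have hgpos : 0 < g := by
    have := h.a_pos
    rw [ha] at this
    exact pos_of_mul_pos_left this hcos.le
  have hx : A.x = g * cos φ := by rw [← p1]; linear_combination -A.x * hcl - sin φ * p2
  have hy : A.y = g * sin φ := by rw [← p1]; linear_combination -A.y * hcl + cos φ * p2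
  have hw : 1 - A.b ^ 2 = (g * sin halfStep) ^ 2 := by
    have := A.quad
    rw [hx, hy, ha] at this
    linear_combination -this + g ^ 2 * hcl - g ^ 2 * hc
  have hw2 : A.w = g * sin halfStep := by
    unfold w; rw [hw, sqrt_sq (by positivity)]
  exact ⟨g, hgpos, hx, hy, ha, hw2, by rw [hw2, hw]⟩

/-- A disk `A` nearly through the centre pushes a nearby edge disk outwards, making tan(θ/2) small.
Separation gives 1 + b_A b_E ≤ g (a_A (cos h − cos t) − tau sin t), with h = `halfStep` and t the
angle from the contact vertex to the edge midpoint; the right side is quadratic in the offset. -/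
theorem inner_bound {A E : NormDisk} {k l : ℤ} (hA : A.Touch k) (hin : A.a ≤ 1.002 * -A.b)
    (hsep : A.Sep E) (h : E.Touch l) (h' : E.Touch (l + 1)) (hj : edgeOffset (l - k) ≤ 50) :
    1 - E.b ≤ 2 * (edgeOffset (l - k) : ℝ) ^ 2 * 0.0138 * E.w := by
  obtain ⟨g, hg, hx, hy, ha, hw, -⟩ := exists_of_touch_touch h h'
  set j : ℝ := (edgeOffset (l - k) : ℝ) with hjdef
  have hj1 : 1 ≤ j := by rw [hjdef]; exact_mod_cast edgeOffset_pos _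
  have hj2 : j ≤ 50 := by rw [hjdef]; exact_mod_cast hj
  set t : ℝ := halfStep * (2 * ((l - k : ℤ) : ℝ) + 1) with ht
  have habs : |t| = halfStep * (2 * j - 1) := by
    rw [ht, abs_mul, abs_edge, abs_of_pos halfStep_pos]
  have hφ : 2 * halfStep * l + halfStep = 2 * halfStep * k + t := by
    rw [ht]; push_cast; ring
  have hsp := hsep
  unfold Sep at hsp
  have hdot := hA.apply_add t
  rw [← hφ] at hdot
  have key : 1 + A.b * E.b ≤ g * (A.a * (cos halfStep - cos t) - A.tau k * sin t) := by
    rw [hx, hy, ha] at hsp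
    have : A.x * (g * cos (2 * halfStep * l + halfStep)) +
        A.y * (g * sin (2 * halfStep * l + halfStep)) = g * (A.a * cos t + A.tau k * sin t) := by
      rw [← hdot]; ring
    linarith
  have hpos := halfStep_pos
  have hapos := hA.a_pos
  have b1 : cos halfStep - cos t ≤ |t| ^ 2 / 2 := by
    have := Real.one_sub_sq_div_two_le_cos (x := t)
    rw [sq_abs]
    linarith [cos_le_one halfStep]
  have b2 : -(A.tau k * sin t) ≤ 0.0134 * A.a * |t| := by
    calc -(A.tau k * sin t) ≤ |A.tau k * sin t| := neg_le_abs _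
      _ = |A.tau k| * |sin t| := abs_mul _ _
      _ ≤ _ := mul_le_mul hA.abs_tau_le abs_sin_le_abs (abs_nonneg _) (by positivity)
  -- In units of `halfStep` squared, (2j − 1)²/2 + (2j − 1) = 2j² − 1/2; the spare 1/2 absorbs the
  -- factor 1.0024 as long as j ≤ 50.
  have b3 : |t| ^ 2 / 2 + 0.0134 * |t| ≤ 2 * j ^ 2 * halfStep ^ 2 := by
    rw [habs]
    have : 0.0134 ≤ 1.0024 * halfStep := by linarith [halfStep_gt]
    have h2j : 0 ≤ halfStep * (2 * j - 1) := by apply mul_nonneg hpos.le; linarith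
    have : 0.0134 * (halfStep * (2 * j - 1)) ≤ 1.0024 * halfStep * (halfStep * (2 * j - 1)) := by
      gcongr
    have : 0 ≤ halfStep ^ 2 * (50 - j) := mul_nonneg (sq_nonneg _) (by linarith)
    nlinarith [sq_nonneg halfStep]
  have b4 : 1 + A.b * E.b ≤ g * A.a * (2 * j ^ 2 * halfStep ^ 2) := by
    calc 1 + A.b * E.b ≤ g * (A.a * (cos halfStep - cos t) - A.tau k * sin t) := key
      _ ≤ g * (A.a * (|t| ^ 2 / 2) + 0.0134 * A.a * |t|) := by
          gcongr
          have := mul_le_mul_of_nonneg_left b1 hapos.le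
          linarith
      _ = g * A.a * (|t| ^ 2 / 2 + 0.0134 * |t|) := by ring
      _ ≤ _ := by gcongr
  have hc : 0 < -A.b := by linarith
  have hc1 : -A.b ≤ 1 := by linarith [hA.b_bounds.2]
  have hE1 := h.b_bounds.1
  have b5 : -A.b * (1 - E.b) ≤ -A.b * (1.002 * g * (2 * j ^ 2 * halfStep ^ 2)) := by
    calc -A.b * (1 - E.b) ≤ 1 + A.b * E.b := by nlinarith
      _ ≤ g * A.a * (2 * j ^ 2 * halfStep ^ 2) := b4
      _ ≤ g * (1.002 * -A.b) * (2 * j ^ 2 * halfStep ^ 2) := by gcongr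
      _ = _ := by ring
  have b6 := le_of_mul_le_mul_left b5 hc
  refine b6.trans ?_
  rw [hw]
  have b7 : 1.002 * halfStep ^ 2 ≤ 0.0138 * sin halfStep := by
    have := halfStep_lt
    have := sin_halfStep_gt
    nlinarith
  calc 1.002 * g * (2 * j ^ 2 * halfStep ^ 2) = 2 * j ^ 2 * g * (1.002 * halfStep ^ 2) := by ring
    _ ≤ 2 * j ^ 2 * g * (0.0138 * sin halfStep) := by gcongr
    _ = _ := by ring

theorem outer_bound {A E : NormDisk} {k l : ℤ} (hA : A.Touch k) (hout : A.a ≤ 1.002 * A.b)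
    (hsep : A.Sep E) (h : E.Touch l) (h' : E.Touch (l + 1)) (hj : edgeOffset (l - k) ≤ 50) :
    1 + E.b ≤ 2 * (edgeOffset (l - k) : ℝ) ^ 2 * 0.0138 * E.w := by
  have := inner_bound (A := A.flip) (E := E.flip) hA.flip (by simpa [flip] using hout)
    hsep.flip h.flip h'.flip hj
  simpa [flip, w] using this

/-- An edge disk cannot be squeezed between an inner and an outer contact disk. -/
theorem no_pair_between {A B E : NormDisk} {k k' l : ℤ} (hA : A.Touch k)
    (hin : A.a ≤ 1.002 * -A.b) (hB : B.Touch k') (hout : B.a ≤ 1.002 * B.b)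
    (hAE : A.Sep E) (hBE : B.Sep E) (h : E.Touch l) (h' : E.Touch (l + 1))
    (hj : edgeOffset (l - k) * edgeOffset (l - k') ≤ 36) : False := by
  obtain ⟨g, hg, hx, hy, ha, hw, hw2⟩ := exists_of_touch_touch h h'
  have p1 := edgeOffset_pos (l - k)
  have p2 := edgeOffset_pos (l - k')
  have i1 := inner_bound hA hin hAE h h' (by nlinarith)
  have i2 := outer_bound hB hout hBE h h' (by nlinarith)
  have hwpos : 0 < E.w := by rw [hw]; exact mul_pos hg sin_halfStep_pos
  have hjr : (edgeOffset (l - k) : ℝ) * (edgeOffset (l - k') : ℝ) ≤ 36 := by exact_mod_cast hj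
  have p1r : (1 : ℝ) ≤ edgeOffset (l - k) := by exact_mod_cast p1
  have p2r : (1 : ℝ) ≤ edgeOffset (l - k') := by exact_mod_cast p2
  set j : ℝ := (edgeOffset (l - k) : ℝ)
  set j' : ℝ := (edgeOffset (l - k') : ℝ)
  -- The product of the two left sides is 1 − b² = w², so 1 ≤ (0.0276 · j · j')². This fails for j ·
  -- j' ≤ 36, as 0.0276 · 36 < 1.
  have e := mul_le_mul i1 i2 (by linarith [h.b_bounds.2]) (by positivity)
  have e2 : (j * j') ^ 2 ≤ 36 ^ 2 := by gcongr
  have e3 : E.w ^ 2 ≤ (2 * 0.0138) ^ 2 * (j * j') ^ 2 * E.w ^ 2 := by nlinarith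
  have e4 : (2 * 0.0138) ^ 2 * (j * j') ^ 2 * E.w ^ 2 ≤ (2 * 0.0138) ^ 2 * 36 ^ 2 * E.w ^ 2 := by
    gcongr
  have : 0 < E.w ^ 2 := by positivity
  norm_num at e4
  nlinarith

/-- Both centres lie on edge axes at angle 2i · `halfStep`, so separation involves only this angle
and the two parameters. -/
theorem pairs_sep {E F : NormDisk} {l i : ℤ} (hE : E.Touch l) (hE' : E.Touch (l + 1))
    (hF : F.Touch (l + i)) (hF' : F.Touch (l + i + 1)) (hsep : E.Sep F) :
    1 + E.b * F.b ≤ E.w * F.w * (2.002 * (i : ℝ) ^ 2) := by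
  obtain ⟨g, hg, hx, hy, ha, hw, -⟩ := exists_of_touch_touch hE hE'
  obtain ⟨g', hg', hx', hy', ha', hw', -⟩ := exists_of_touch_touch hF hF'
  unfold Sep at hsep
  rw [hx, hy, ha, hx', hy', ha'] at hsep
  rw [hw, hw']
  have e1 : 2 * halfStep * ((l + i : ℤ) : ℝ) + halfStep =
      (2 * halfStep * l + halfStep) + 2 * halfStep * i := by push_cast; ring
  rw [e1] at hsep
  have hc := sin_sq_add_cos_sq (2 * halfStep * l + halfStep)
  have hc2 := sin_sq_add_cos_sq halfStep
  generalize 2 * halfStep * l + halfStep = φ at hsep hc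
  rw [cos_add, sin_add] at hsep
  have b1 := Real.one_sub_sq_div_two_le_cos (x := 2 * halfStep * i)
  have e2 : 1 + E.b * F.b ≤ g * g' * (cos halfStep ^ 2 - cos (2 * halfStep * i)) := by
    linear_combination hsep - g * g' * cos (2 * halfStep * i) * hc
  have e3 : cos halfStep ^ 2 - cos (2 * halfStep * i) ≤ 2 * halfStep ^ 2 * i ^ 2 := by
    nlinarith [sq_nonneg (sin halfStep)]
  have e4 : halfStep ^ 2 ≤ 1.001 * sin halfStep ^ 2 := by
    have := halfStep_lt
    have := halfStep_gt
    have := sin_halfStep_gt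
    nlinarith
  calc 1 + E.b * F.b ≤ g * g' * (cos halfStep ^ 2 - cos (2 * halfStep * i)) := e2
    _ ≤ g * g' * (2 * halfStep ^ 2 * i ^ 2) := by gcongr
    _ ≤ g * g' * (2 * (1.001 * sin halfStep ^ 2) * i ^ 2) := by gcongr
    _ = _ := by ring

/-- Two edge disks near an inner contact disk overlap. -/
theorem no_two_pairs_inner {A E F : NormDisk} {k k' l i : ℤ} (hA : A.Touch k) (hA' : A.Touch k')
    (hin : A.a ≤ 1.002 * -A.b) (hAE : A.Sep E) (hAF : A.Sep F) (hsep : E.Sep F)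
    (hE : E.Touch l) (hE' : E.Touch (l + 1)) (hF : F.Touch (l + i)) (hF' : F.Touch (l + i + 1))
    (hj : edgeOffset (l - k) * edgeOffset (l + i - k') * |i| ≤ 16) (hi : i ≠ 0) : False := by
  have p1 := edgeOffset_pos (l - k)
  have p2 := edgeOffset_pos (l + i - k')
  have p3 : 1 ≤ |i| := Int.one_le_abs hi
  have q12 : edgeOffset (l - k) * edgeOffset (l + i - k') ≤ 16 := by nlinarith
  have i1 := inner_bound hA hin hAE hE hE' (by nlinarith)
  have i2 := inner_bound hA' hin hAF hF hF' (by nlinarith)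
  have s := pairs_sep hE hE' hF hF' hsep
  obtain ⟨g, hg, -, -, -, hw, hw2⟩ := exists_of_touch_touch hE hE'
  obtain ⟨g', hg', -, -, -, hw', hw2'⟩ := exists_of_touch_touch hF hF'
  have hwpos : 0 < E.w := by rw [hw]; exact mul_pos hg sin_halfStep_pos
  have hwpos' : 0 < F.w := by rw [hw']; exact mul_pos hg' sin_halfStep_pos
  have p1r : (1 : ℝ) ≤ edgeOffset (l - k) := by exact_mod_cast p1
  have p2r : (1 : ℝ) ≤ edgeOffset (l + i - k') := by exact_mod_cast p2
  have hjr : (edgeOffset (l - k) : ℝ) * (edgeOffset (l + i - k') : ℝ) * |(i : ℝ)| ≤ 16 := by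
    exact_mod_cast hj
  set j : ℝ := (edgeOffset (l - k) : ℝ)
  set j' : ℝ := (edgeOffset (l + i - k') : ℝ)
  -- The bound from the contact disk is multiplied by 1 + b, and 1 − b² = w² turns it into an upper
  -- bound for w.
  have m1 : E.w ≤ 2 * j ^ 2 * 0.0138 * (1 + E.b) := by
    apply le_of_mul_le_mul_left _ hwpos
    have := hE.b_bounds.2
    nlinarith
  have m2 : F.w ≤ 2 * j' ^ 2 * 0.0138 * (1 + F.b) := by
    apply le_of_mul_le_mul_left _ hwpos'
    have := hF.b_bounds.2
    nlinarith
  have bE := hE.b_bounds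
  have bF := hF.b_bounds
  have m3 := mul_le_mul m1 m2 hwpos'.le (by have := bE.2; have : 0 ≤ 1 + E.b := by linarith
                                            positivity)
  -- Equivalent to (1 − b)(1 − b') ≥ 0; it links the two tilt bounds to the separation inequality.
  have m4 : (1 + E.b) * (1 + F.b) ≤ 2 * (1 + E.b * F.b) := by
    nlinarith [mul_nonneg (sub_nonneg.2 bE.1) (sub_nonneg.2 bF.1)]
  have m5 : (j * j' * |(i : ℝ)|) ^ 2 ≤ 16 ^ 2 := by gcongr
  have m6 : E.w * F.w ≤ (2 * 0.0138) ^ 2 * (j * j') ^ 2 * (2 * (E.w * F.w * (2.002 * (i : ℝ) ^ 2))) := by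
    calc E.w * F.w ≤ (2 * 0.0138) ^ 2 * (j * j') ^ 2 * ((1 + E.b) * (1 + F.b)) := by
          refine m3.trans (le_of_eq ?_); ring
      _ ≤ _ := mul_le_mul_of_nonneg_left (by linarith) (by positivity)
  have hww : 0 < E.w * F.w := by positivity
  have m7 : (j * j') ^ 2 * (i : ℝ) ^ 2 ≤ 16 ^ 2 := by
    rw [mul_pow, sq_abs] at m5; exact m5
  have m8 : (2 * 0.0138) ^ 2 * (j * j') ^ 2 * (2 * (E.w * F.w * (2.002 * (i : ℝ) ^ 2))) =
      E.w * F.w * (4.004 * (2 * 0.0138) ^ 2) * ((j * j') ^ 2 * (i : ℝ) ^ 2) := by ring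
  rw [m8] at m6
  have m9 : E.w * F.w * (4.004 * (2 * 0.0138) ^ 2) * ((j * j') ^ 2 * (i : ℝ) ^ 2) ≤
      E.w * F.w * (4.004 * (2 * 0.0138) ^ 2) * 16 ^ 2 := by gcongr
  -- The total factor 4.004 · 0.0276² · 16² is about 0.78, below 1.
  norm_num at m9 m6
  nlinarith

theorem no_two_pairs_outer {A E F : NormDisk} {k k' l i : ℤ} (hA : A.Touch k) (hA' : A.Touch k')
    (hout : A.a ≤ 1.002 * A.b) (hAE : A.Sep E) (hAF : A.Sep F) (hsep : E.Sep F)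
    (hE : E.Touch l) (hE' : E.Touch (l + 1)) (hF : F.Touch (l + i)) (hF' : F.Touch (l + i + 1))
    (hj : edgeOffset (l - k) * edgeOffset (l + i - k') * |i| ≤ 16) (hi : i ≠ 0) : False :=
  no_two_pairs_inner (A := A.flip) (E := E.flip) (F := F.flip) hA.flip hA'.flip
    (by simpa [flip] using hout) hAE.flip hAF.flip hsep.flip hE hE' hF hF' hj hi

end NormDisk

/-! ### Large disks and disks through the centre. -/

namespace NormDisk

/-- Since a ≥ 0, `b` is at least −0.001, and the small tangential component forces b² close to 1. So
the disk is almost a half-plane bounded by a tangent of the unit circle. -/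
theorem Touch.large {A : NormDisk} {k : ℤ} (h : A.Touch k) (hr : A.a - A.b ≤ 0.001) :
    A.a ≤ 1.002 * A.b ∧ A.a ≤ 1.001 ∧ 0.9997 ≤ A.b := by
  have h1 := h.sq_tau
  have h2 := h.abs_tau_le
  have h3 := h.b_bounds
  have h4 := h.a_pos
  have ha : A.a ≤ 1.001 := by linarith [h3.1]
  have h5 : A.tau k ^ 2 ≤ (0.0134 * 1.001) ^ 2 := by
    rw [← sq_abs]
    gcongr
    linarith
  have hb : 0.9997 ≤ A.b := by
    by_contra hcon
    push Not at hcon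
    have : -0.001 ≤ A.b := by linarith
    norm_num at h5
    nlinarith
  exact ⟨by linarith, ha, hb⟩

/-- Two large disks touching nearby vertices overlap. -/
theorem no_two_large {A B : NormDisk} {k e : ℤ} (hA : A.Touch k) (hB : B.Touch (k + e))
    (hrA : A.a - A.b ≤ 0.001) (hrB : B.a - B.b ≤ 0.001) (he : |e| ≤ 26) (hsep : A.Sep B) :
    False := by
  obtain ⟨-, a1, b1⟩ := hA.large hrA
  obtain ⟨-, a2, b2⟩ := hB.large hrB
  have t1 := hA.abs_tau_le
  have t2 := hB.abs_tau_le
  have bA := hA.b_bounds.1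
  have bB := hB.b_bounds.1
  have la := A.le_a
  have lb := B.le_a
  set y : ℝ := 2 * halfStep * e with hy
  have p1 := hB.apply_add (-y)
  have p2 := hB.apply_tangent (-y)
  have e1 : 2 * halfStep * ((k + e : ℤ) : ℝ) + -y = 2 * halfStep * k := by
    rw [hy]; push_cast; ring
  rw [e1, cos_neg, sin_neg] at p1 p2
  have hA' : A.x * cos (2 * halfStep * k) + A.y * sin (2 * halfStep * k) = A.a := hA
  have ht : A.tau k = -A.x * sin (2 * halfStep * k) + A.y * cos (2 * halfStep * k) := rfl
  have hc := sin_sq_add_cos_sq (2 * halfStep * k)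
  -- Both centre vectors are resolved in the frame at vertex `k`. The inner product is then positive
  -- up to angle 0.6952, while a a' − b b' is nearly 0, so the separation value stays below 1.
  have dot : A.x * B.x + A.y * B.y = A.a * (B.a * cos y - B.tau (k + e) * sin y) +
      A.tau k * (B.tau (k + e) * cos y + B.a * sin y) := by
    have q1 : B.a * cos y - B.tau (k + e) * sin y =
      B.x * cos (2 * halfStep * k) + B.y * sin (2 * halfStep * k) := by rw [p1]; ring
    have q2 : B.tau (k + e) * cos y + B.a * sin y =
      -B.x * sin (2 * halfStep * k) + B.y * cos (2 * halfStep * k) := by rw [p2]; ring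
    rw [q1, q2, ← hA', ht]
    linear_combination -(A.x * B.x + A.y * B.y) * hc
  have her : |(e : ℝ)| ≤ 26 := by exact_mod_cast he
  have hyabs : |y| ≤ 0.6952 := by
    rw [hy, abs_mul, abs_of_pos (by linarith [halfStep_pos])]
    have := halfStep_lt
    have := halfStep_pos
    nlinarith [abs_nonneg (e : ℝ)]
  have hcos : 0.75 ≤ cos y := by
    have := Real.one_sub_sq_div_two_le_cos (x := y)
    have h2 : y ^ 2 ≤ 0.6952 ^ 2 := by rw [← sq_abs]; gcongr
    norm_num at h2
    linarith
  have hcos1 := cos_le_one y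
  have hs := abs_sin_le_one y
  have tB : |B.tau (k + e)| ≤ 0.01342 := by linarith
  have tA : |A.tau k| ≤ 0.01342 := by linarith
  have r1 : B.a * cos y - B.tau (k + e) * sin y ≥ 0.73 := by
    have : |B.tau (k + e) * sin y| ≤ 0.01342 * 1 := by
      rw [abs_mul]; gcongr
    have := le_abs_self (B.tau (k + e) * sin y)
    nlinarith
  have r2 : |A.tau k * (B.tau (k + e) * cos y + B.a * sin y)| ≤ 0.01342 * 2 := by
    rw [abs_mul]
    gcongr
    calc _ ≤ |B.tau (k + e) * cos y| + |B.a * sin y| := abs_add_le _ _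
      _ ≤ 0.01342 * 1 + 1.001 * 1 := by
        rw [abs_mul, abs_mul, abs_of_pos (by linarith : 0 < B.a)]
        gcongr
        exact abs_cos_le_one y
      _ ≤ 2 := by norm_num
  have r3 := (abs_le.1 r2).1
  unfold Sep at hsep
  have r4 : 0.9997 * 0.73 ≤ A.a * (B.a * cos y - B.tau (k + e) * sin y) :=
    mul_le_mul (by linarith) r1 (by norm_num) (by linarith)
  have r5 : A.a * B.a ≤ 1.001 * 1.001 := by gcongr; linarith
  have r6 : 0.9997 * 0.9997 ≤ A.b * B.b := by gcongr
  norm_num at r3 r4 r5 r6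
  linarith

/-- A disk touching the centre is small. -/
theorem center_small {A : NormDisk} (h : A.a = -A.b) : 0.1 ≤ A.a := by
  have hq := A.quad
  have hxy : A.x ^ 2 + A.y ^ 2 = 1 := by rw [hq, h]; ring
  obtain ⟨φ, hφx, hφy⟩ : ∃ φ, A.x = cos φ ∧ A.y = sin φ := by
    have hn : ‖(⟨A.x, A.y⟩ : ℂ)‖ = 1 := by
      rw [Complex.norm_def, Complex.normSq_mk, sqrt_eq_one]; nlinarith
    refine ⟨Complex.arg ⟨A.x, A.y⟩, ?_, ?_⟩
    · have := Complex.norm_mul_cos_arg ⟨A.x, A.y⟩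
      rw [hn, one_mul] at this; exact this.symm
    · have := Complex.norm_mul_sin_arg ⟨A.x, A.y⟩
      rw [hn, one_mul] at this; exact this.symm
  have hpos := halfStep_pos
  -- The floor selects a vertex direction within one step, 2 · `halfStep`, of the direction of the
  -- centre.
  have he := A.empty ⌊φ / (2 * halfStep)⌋
  rw [hφx, hφy, ← cos_sub] at he
  have f1 := Int.floor_le (φ / (2 * halfStep))
  have f2 := Int.lt_floor_add_one (φ / (2 * halfStep))
  rw [le_div_iff₀ (by positivity)] at f1
  rw [div_lt_iff₀ (by positivity)] at f2
  set m : ℝ := (⌊φ / (2 * halfStep)⌋ : ℝ)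
  have h1 : |φ - 2 * halfStep * m| ≤ 0.1 := by
    rw [abs_le]
    have := halfStep_lt
    constructor <;> linarith
  have h2 : (φ - 2 * halfStep * m) ^ 2 ≤ 0.1 ^ 2 := by rw [← sq_abs]; gcongr
  have := Real.one_sub_sq_div_two_le_cos (x := φ - 2 * halfStep * m)
  norm_num at h2
  linarith

end NormDisk

/-! ### From disks in the plane to Lorentz coordinates. -/

/-- The vertices of the regular 235-gon with circumradius `1` centred at `z`. -/
noncomputable def vertex (z : Plane) (k : ℤ) : Plane :=
  z + !₂[cos (2 * halfStep * k), sin (2 * halfStep * k)]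

theorem dist_vertex (z : Plane) (k : ℤ) : dist (vertex z k) z = 1 := by
  rw [EuclideanSpace.dist_eq]
  simp [vertex, Fin.sum_univ_two]

namespace Disk

theorem dist_center_sq (Q : Disk) (p : Plane) :
    dist p Q.center ^ 2 = (p 0 - Q.center 0) ^ 2 + (p 1 - Q.center 1) ^ 2 := by
  rw [EuclideanSpace.dist_sq_eq, Fin.sum_univ_two, Real.dist_eq, Real.dist_eq, sq_abs, sq_abs]

theorem notMem_interior_iff (Q : Disk) (p : Plane) :
    p ∉ Q.interior ↔ Q.radius ^ 2 ≤ (p 0 - Q.center 0) ^ 2 + (p 1 - Q.center 1) ^ 2 := by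
  rw [← dist_center_sq, interior, Metric.mem_ball, not_lt]
  exact (pow_le_pow_iff_left₀ Q.radius_pos.le dist_nonneg two_ne_zero).symm

theorem mem_boundary_iff (Q : Disk) (p : Plane) :
    p ∈ Q.boundary ↔ (p 0 - Q.center 0) ^ 2 + (p 1 - Q.center 1) ^ 2 = Q.radius ^ 2 := by
  rw [← dist_center_sq, boundary, Metric.mem_sphere]
  exact (pow_left_inj₀ dist_nonneg Q.radius_pos.le two_ne_zero).symm

/-- The power of the point `z` with respect to a disk. -/
noncomputable def power (Q : Disk) (z : Plane) : ℝ :=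
  (z 0 - Q.center 0) ^ 2 + (z 1 - Q.center 1) ^ 2 - Q.radius ^ 2

theorem vertex_expand (Q : Disk) (z : Plane) (k : ℤ) :
    (vertex z k 0 - Q.center 0) ^ 2 + (vertex z k 1 - Q.center 1) ^ 2 - Q.radius ^ 2 =
      2 * Q.radius * ((Q.power z + 1) / (2 * Q.radius) -
        ((Q.center 0 - z 0) / Q.radius * cos (2 * halfStep * k) +
          (Q.center 1 - z 1) / Q.radius * sin (2 * halfStep * k))) := by
  have hr := Q.radius_pos.ne'
  have hc := sin_sq_add_cos_sq (2 * halfStep * k)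
  have e0 : vertex z k 0 = z 0 + cos (2 * halfStep * k) := by simp [vertex]
  have e1 : vertex z k 1 = z 1 + sin (2 * halfStep * k) := by simp [vertex]
  rw [e0, e1, power]
  field_simp
  linear_combination hc

/-- The coordinates of a disk adapted to the unit circle with centre `z`. -/
noncomputable def toNormDisk (Q : Disk) (z : Plane) (hz : z ∉ Q.interior)
    (hv : ∀ k, vertex z k ∉ Q.interior) : NormDisk where
  x := (Q.center 0 - z 0) / Q.radius
  y := (Q.center 1 - z 1) / Q.radius
  a := (Q.power z + 1) / (2 * Q.radius)
  b := (Q.power z - 1) / (2 * Q.radius)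
  quad := by
    have hr := Q.radius_pos.ne'
    unfold power
    field_simp
    ring
  le_a := by
    have hr := Q.radius_pos
    gcongr
    linarith
  neg_le_a := by
    have hr := Q.radius_pos
    rw [notMem_interior_iff] at hz
    rw [← neg_div]
    gcongr
    unfold power
    linarith
  empty k := by
    have hr := Q.radius_pos
    have h := hv k
    rw [notMem_interior_iff, ← sub_nonneg, vertex_expand] at h
    have := nonneg_of_mul_nonneg_right h (by positivity)
    linarith

variable {Q Q' : Disk} {z : Plane} (hz : z ∉ Q.interior) (hv : ∀ k, vertex z k ∉ Q.interior)
  (hz' : z ∉ Q'.interior) (hv' : ∀ k, vertex z k ∉ Q'.interior)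

theorem touch_toNormDisk_iff (k : ℤ) :
    (Q.toNormDisk z hz hv).Touch k ↔ vertex z k ∈ Q.boundary := by
  have hr := Q.radius_pos
  rw [mem_boundary_iff, ← sub_eq_zero, vertex_expand, mul_eq_zero_iff_left (by positivity),
    sub_eq_zero]
  exact eq_comm

theorem a_sub_b_toNormDisk : (Q.toNormDisk z hz hv).a - (Q.toNormDisk z hz hv).b = 1 / Q.radius := by
  have hr := Q.radius_pos.ne'
  simp only [toNormDisk]
  field_simp
  ring

theorem a_eq_neg_b_toNormDisk (h : z ∈ Q.boundary) :
    (Q.toNormDisk z hz hv).a = -(Q.toNormDisk z hz hv).b := by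
  have hr := Q.radius_pos.ne'
  rw [mem_boundary_iff] at h
  simp only [toNormDisk, power, h]
  field_simp
  ring

/-- The Lorentz product equals (|c − c'|² − r² − r'²) / (2 r r'), which is at least 1 exactly when
|c − c'| ≥ r + r'. -/
theorem sep_toNormDisk (h : Disjoint Q.interior Q'.interior) :
    (Q.toNormDisk z hz hv).Sep (Q'.toNormDisk z hz' hv') := by
  have hr := Q.radius_pos
  have hr' := Q'.radius_pos
  unfold interior at h
  rw [disjoint_ball_ball_iff hr hr'] at h
  have h2 : (Q.radius + Q'.radius) ^ 2 ≤ dist Q.center Q'.center ^ 2 := by gcongr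
  rw [dist_center_sq] at h2
  unfold NormDisk.Sep
  simp only [toNormDisk, power]
  rw [← sub_nonneg]
  have : 0 ≤ ((Q.center 0 - Q'.center 0) ^ 2 + (Q.center 1 - Q'.center 1) ^ 2 -
      (Q.radius + Q'.radius) ^ 2) / (2 * Q.radius * Q'.radius) :=
    div_nonneg (by linarith) (by positivity)
  refine this.trans_eq ?_
  field_simp
  ring

end Disk

end

/-! ### Combinatorics of contact patterns on the cycle of 235 vertices. -/

theorem card_le_card_of_windows {ι α : Type*} [DecidableEq α] (I : Finset ι) (W : ι → Finset α)
    (hW : ∀ i ∈ I, ∀ j ∈ I, i ≠ j → Disjoint (W i) (W j)) (T S : Finset α)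
    (hT : T ⊆ I.biUnion W) (h : ∀ i ∈ I, (T ∩ W i).card ≤ (S ∩ W i).card) :
    T.card ≤ S.card := by
  calc T.card ≤ (I.biUnion fun i => T ∩ W i).card := by
        apply Finset.card_le_card
        intro t ht
        obtain ⟨i, hi, hti⟩ := Finset.mem_biUnion.1 (hT ht)
        exact Finset.mem_biUnion.2 ⟨i, hi, Finset.mem_inter.2 ⟨ht, hti⟩⟩
    _ ≤ ∑ i ∈ I, (T ∩ W i).card := Finset.card_biUnion_le
    _ ≤ ∑ i ∈ I, (S ∩ W i).card := Finset.sum_le_sum h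
    _ = (I.biUnion fun i => S ∩ W i).card := by
        symm
        apply Finset.card_biUnion
        intro i hi j hj hij
        exact (hW i hi j hj hij).mono Finset.inter_subset_right Finset.inter_subset_right
    _ ≤ S.card := by
        apply Finset.card_le_card
        intro s hs
        obtain ⟨i, -, hi⟩ := Finset.mem_biUnion.1 hs
        exact (Finset.mem_inter.1 hi).1

/-- The pattern in which a family of disks touches the vertices of a regular 235-gon. The disks
are divided into outer contact disks, inner contact disks and the rest. -/
structure ContactPattern (ι : Type*) where
  outer : Finset ι
  inner : Finset ι
  rest : Finset ι
  tch : ι → ZMod 235 → Prop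
  pick : ZMod 235 → ι
  inner_unique : ∀ Q ∈ inner, ∀ Q' ∈ inner, Q = Q'
  touches : ∀ Q, Q ∈ outer ∨ Q ∈ inner → ∃ k, tch Q k
  adjacent : ∀ Q, Q ∈ outer ∨ Q ∈ inner ∨ Q ∈ rest → ∀ k l, tch Q k → tch Q l →
    l = k ∨ l = k + 1 ∨ k = l + 1
  pick_spec : ∀ k, (∀ Q, Q ∈ outer ∨ Q ∈ inner → ¬ tch Q k) → pick k ∈ rest ∧ tch (pick k) k
  right : ∀ Q, Q ∈ outer ∨ Q ∈ inner → ∀ k, tch Q k → ∀ E ∈ rest, ∀ F ∈ rest,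
    tch E (k + 1) → tch E (k + 2) → tch F (k + 3) → tch F (k + 4) → False
  left : ∀ Q, Q ∈ outer ∨ Q ∈ inner → ∀ k, tch Q k → ∀ E ∈ rest, ∀ F ∈ rest,
    tch E (k - 2) → tch E (k - 1) → tch F (k - 4) → tch F (k - 3) → False
  outer_far : ∀ Q ∈ outer, ∀ Q' ∈ outer, Q ≠ Q' → ∀ (k : ZMod 235) (e : ℤ), |e| ≤ 26 →
    tch Q k → tch Q' (k + e) → False
  squeeze : ∀ D ∈ inner, ∀ B ∈ outer, ∀ (k : ZMod 235) (i j : ℤ), tch D k → tch B (k + i) →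
    edgeOffset j * edgeOffset (j - i) ≤ 36 → ∀ E ∈ rest, tch E (k + j) → tch E (k + j + 1) → False

namespace ContactPattern

variable {ι : Type*} (c : ContactPattern ι)

/-- The contact disks. -/
def IsContact (Q : ι) : Prop := Q ∈ c.outer ∨ Q ∈ c.inner

open Classical in
/-- The vertices touched by a contact disk. -/
noncomputable def touched : Finset (ZMod 235) :=
  Finset.univ.filter fun k => ∃ Q, c.IsContact Q ∧ c.tch Q k

open Classical in
/-- The vertices that do not share their disk. -/
noncomputable def single : Finset (ZMod 235) :=
  Finset.univ.filter fun k => k ∉ c.touched ∧ ∀ l, l ∉ c.touched → c.pick l = c.pick k → l = k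

/-- The vertices `l` and `l + 1` share a disk. -/
def Paired (l : ZMod 235) : Prop :=
  l ∉ c.touched ∧ l + 1 ∉ c.touched ∧ c.pick l = c.pick (l + 1)

theorem mem_touched {k : ZMod 235} : k ∈ c.touched ↔ ∃ Q, c.IsContact Q ∧ c.tch Q k := by
  simp [touched]

theorem pick_mem {k : ZMod 235} (h : k ∉ c.touched) :
    c.pick k ∈ c.rest ∧ c.tch (c.pick k) k := by
  apply c.pick_spec
  intro Q hQ ht
  exact h (c.mem_touched.2 ⟨Q, hQ, ht⟩)

variable {c}

theorem Paired.exists {l : ZMod 235} (h : c.Paired l) :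
    ∃ E ∈ c.rest, c.tch E l ∧ c.tch E (l + 1) := by
  obtain ⟨h1, h2, h3⟩ := h
  refine ⟨c.pick l, (c.pick_mem h1).1, (c.pick_mem h1).2, ?_⟩
  rw [h3]; exact (c.pick_mem h2).2

theorem eq_or_paired {k l : ZMod 235} (hk : k ∉ c.touched) (hl : l ∉ c.touched)
    (h : c.pick l = c.pick k) : l = k ∨ (l = k + 1 ∧ c.Paired k) ∨ (l = k - 1 ∧ c.Paired (k - 1)) := by
  have h1 := c.pick_mem hk
  have h2 := c.pick_mem hl
  rw [h] at h2
  rcases c.adjacent _ (Or.inr (Or.inr h1.1)) k l h1.2 h2.2 with e | e | e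
  · exact Or.inl e
  · subst e; exact Or.inr (Or.inl ⟨rfl, hk, hl, h.symm⟩)
  · subst e
    refine Or.inr (Or.inr ⟨by ring, ?_⟩)
    rw [add_sub_cancel_right]
    exact ⟨hl, hk, h⟩

theorem mem_single {k : ZMod 235} (hk : k ∉ c.touched) (h1 : ¬ c.Paired k)
    (h2 : ¬ c.Paired (k - 1)) : k ∈ c.single := by
  simp only [single, Finset.mem_filter, Finset.mem_univ, true_and]
  refine ⟨hk, fun l hl hlk => ?_⟩
  rcases eq_or_paired hk hl hlk with e | e | e
  · exact e
  · exact absurd e.2 h1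
  · exact absurd e.2 h2

/-- Otherwise one disk would touch two vertices that are two steps apart. -/
theorem Paired.not_succ {l : ZMod 235} (h : c.Paired l) : ¬ c.Paired (l + 1) := by
  rintro ⟨h1, h2, h3⟩
  obtain ⟨h4, -, h6⟩ := h
  have e1 := c.pick_mem h4
  have e2 := c.pick_mem h2
  rw [← h3, ← h6] at e2
  rcases c.adjacent _ (Or.inr (Or.inr e1.1)) _ _ e1.2 e2.2 with e | e | e
  · have : (2 : ZMod 235) = 0 := by linear_combination e
    exact absurd this (by decide)
  · have : (1 : ZMod 235) = 0 := by linear_combination e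
    exact absurd this (by decide)
  · have : (3 : ZMod 235) = 0 := by linear_combination -e
    exact absurd this (by decide)

-- Each remaining disk contributes at most 2: either it is picked by at most two untouched vertices,
-- none single, or by exactly one, which then counts twice.
open Classical in
theorem card_compl_touched_add_card_single : (c.touchedᶜ).card + c.single.card ≤ 2 * c.rest.card := by
  have m1 : ∀ k ∈ c.touchedᶜ, c.pick k ∈ c.rest := fun k hk =>
    (c.pick_mem (Finset.mem_compl.1 hk)).1
  have m2 : ∀ k ∈ c.single, c.pick k ∈ c.rest := fun k hk =>
    (c.pick_mem (Finset.mem_filter.1 hk).2.1).1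
  rw [Finset.card_eq_sum_card_fiberwise m1, Finset.card_eq_sum_card_fiberwise m2,
    ← Finset.sum_add_distrib, mul_comm]
  apply Finset.sum_le_card_nsmul
  intro E _
  by_cases hs : ∃ k ∈ c.single, c.pick k = E
  · obtain ⟨k, hk, rfl⟩ := hs
    have hk' := (Finset.mem_filter.1 hk).2
    have a1 : {l ∈ c.touchedᶜ | c.pick l = c.pick k} ⊆ {k} := by
      intro l hl
      rw [Finset.mem_filter, Finset.mem_compl] at hl
      exact Finset.mem_singleton.2 (hk'.2 l hl.1 hl.2)
    have a2 : {l ∈ c.single | c.pick l = c.pick k} ⊆ {k} := by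
      intro l hl
      rw [Finset.mem_filter] at hl
      exact Finset.mem_singleton.2 (hk'.2 l (Finset.mem_filter.1 hl.1).2.1 hl.2)
    have b1 := Finset.card_le_card a1
    have b2 := Finset.card_le_card a2
    rw [Finset.card_singleton] at b1 b2
    omega
  · have a2 : {l ∈ c.single | c.pick l = E} = ∅ := by
      rw [Finset.filter_eq_empty_iff]
      intro l hl he
      exact hs ⟨l, hl, he⟩
    rw [a2, Finset.card_empty, add_zero]
    rcases Finset.eq_empty_or_nonempty {l ∈ c.touchedᶜ | c.pick l = E} with h0 | ⟨k, hk⟩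
    · rw [h0]; simp
    · rw [Finset.mem_filter, Finset.mem_compl] at hk
      have key : {l ∈ c.touchedᶜ | c.pick l = E} ⊆ {k, k + 1} ∨
          {l ∈ c.touchedᶜ | c.pick l = E} ⊆ {k, k - 1} := by
        by_cases hp : c.Paired k
        · left
          intro l hl
          rw [Finset.mem_filter, Finset.mem_compl] at hl
          rcases eq_or_paired hk.1 hl.1 (hl.2.trans hk.2.symm) with e | e | e
          · simp [e]
          · simp [e.1]
          · exact absurd (by rw [sub_add_cancel]; exact hp) e.2.not_succ
        · right
          intro l hl
          rw [Finset.mem_filter, Finset.mem_compl] at hl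
          rcases eq_or_paired hk.1 hl.1 (hl.2.trans hk.2.symm) with e | e | e
          · simp [e]
          · exact absurd e.2 hp
          · simp [e.1]
      rcases key with h | h <;> exact (Finset.card_le_card h).trans Finset.card_le_two

open Classical in
/-- The vertices at distance at most `M` from `k`. -/
noncomputable def window (k : ZMod 235) (M : ℤ) : Finset (ZMod 235) :=
  (Finset.Icc (-M) M).image fun e : ℤ => k + (e : ZMod 235)

theorem mem_window {k l : ZMod 235} {M : ℤ} : l ∈ window k M ↔ ∃ e : ℤ, |e| ≤ M ∧ l = k + e := by
  simp only [window, Finset.mem_image, Finset.mem_Icc, abs_le]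
  constructor <;> rintro ⟨e, h1, h2⟩ <;> exact ⟨e, h1, h2.symm⟩

theorem exists_ends {Q : ι} (hQ : c.IsContact Q) {k : ZMod 235} (hk : c.tch Q k) :
    ∃ l r : ZMod 235, c.tch Q l ∧ c.tch Q r ∧ (l = k ∧ r = k ∨ l = k ∧ r = k + 1 ∨ l = k - 1 ∧ r = k) ∧
      ∀ m, c.tch Q m → m = l ∨ m = r := by
  have adj : ∀ k l, c.tch Q k → c.tch Q l → l = k ∨ l = k + 1 ∨ k = l + 1 :=
    c.adjacent Q (by rcases hQ with h | h <;> simp [h])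
  by_cases h1 : c.tch Q (k + 1)
  · refine ⟨k, k + 1, hk, h1, by simp, fun m hm => ?_⟩
    rcases adj k m hk hm with e | e | e
    · exact Or.inl e
    · exact Or.inr e
    · exfalso
      rcases adj (k + 1) m h1 hm with e' | e' | e'
      · have : (2 : ZMod 235) = 0 := by linear_combination -e - e'
        exact absurd this (by decide)
      · have : (3 : ZMod 235) = 0 := by linear_combination -e - e'
        exact absurd this (by decide)
      · have : (1 : ZMod 235) = 0 := by linear_combination e' - e
        exact absurd this (by decide)
  · by_cases h2 : c.tch Q (k - 1)
    · refine ⟨k - 1, k, h2, hk, by simp, fun m hm => ?_⟩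
      rcases adj k m hk hm with e | e | e
      · exact Or.inr e
      · subst e; exact absurd hm h1
      · left; rw [e]; ring
    · refine ⟨k, k, hk, hk, by simp, fun m hm => ?_⟩
      rcases adj k m hk hm with e | e | e
      · exact Or.inl e
      · subst e; exact absurd hm h1
      · have : m = k - 1 := by rw [e]; ring
        subst this; exact absurd hm h2

-- An isolated contact disk touches at most two vertices and yields a single vertex on each side. To
-- the right of its last vertex r, the vertex r + 1 is single unless paired with r + 2; then r + 3
-- cannot pair with r + 2, nor with r + 4 by `right`. The left side is symmetric.
open Classical in
theorem card_window {Q : ι} (hQ : c.IsContact Q) {k : ZMod 235} (hk : c.tch Q k)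
    (hfar : ∀ C, c.IsContact C → ∀ e : ℤ, |e| ≤ 4 → c.tch C (k + e) → C = Q) :
    (c.touched ∩ window k 4).card ≤ (c.single ∩ window k 4).card := by
  obtain ⟨l, r, hl, hr, hlr, hall⟩ := exists_ends hQ hk
  have h1 : c.touched ∩ window k 4 ⊆ {l, r} := by
    intro m hm
    rw [Finset.mem_inter, mem_window, mem_touched] at hm
    obtain ⟨⟨C, hC, hCm⟩, e, he, rfl⟩ := hm
    rw [hfar C hC e he hCm] at hCm
    simpa using hall _ hCm
  refine ((Finset.card_le_card h1).trans Finset.card_le_two).trans ?_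
  have hnot : ∀ m, m ∈ window k 4 → m ≠ l → m ≠ r → m ∉ c.touched := by
    intro m hm n1 n2 hmt
    have := h1 (Finset.mem_inter.2 ⟨hmt, hm⟩)
    rw [Finset.mem_insert, Finset.mem_singleton] at this
    exact this.elim n1 n2
  have hlt : l ∈ c.touched := c.mem_touched.2 ⟨Q, hQ, hl⟩
  have hrt : r ∈ c.touched := c.mem_touched.2 ⟨Q, hQ, hr⟩
  have hwin : ∀ m : ZMod 235, ∀ e : ℤ, |e| ≤ 4 → m = k + e → m ∈ window k 4 :=
    fun m e he h => mem_window.2 ⟨e, he, h⟩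
  have hw : r + 1 ∈ window k 4 ∧ r + 3 ∈ window k 4 ∧ l - 1 ∈ window k 4 ∧ l - 3 ∈ window k 4 := by
    rcases hlr with ⟨rfl, rfl⟩ | ⟨rfl, rfl⟩ | ⟨rfl, rfl⟩
    · exact ⟨hwin _ 1 (by decide) (by push_cast; ring), hwin _ 3 (by decide) (by push_cast; ring),
        hwin _ (-1) (by decide) (by push_cast; ring), hwin _ (-3) (by decide) (by push_cast; ring)⟩
    · exact ⟨hwin _ 2 (by decide) (by push_cast; ring), hwin _ 4 (by decide) (by push_cast; ring),
        hwin _ (-1) (by decide) (by push_cast; ring), hwin _ (-3) (by decide) (by push_cast; ring)⟩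
    · exact ⟨hwin _ 1 (by decide) (by push_cast; ring), hwin _ 3 (by decide) (by push_cast; ring),
        hwin _ (-2) (by decide) (by push_cast; ring), hwin _ (-4) (by decide) (by push_cast; ring)⟩
  have hlr' : r = l ∨ r = l + 1 := by
    rcases hlr with ⟨rfl, rfl⟩ | ⟨rfl, rfl⟩ | ⟨rfl, rfl⟩
    · simp
    · simp
    · right; ring
  have shift : ∀ d : ZMod 235, d ≠ 0 → ∀ m : ZMod 235, m + d ≠ m := fun d hd m h =>
    hd (by linear_combination h)
  have r1 : r + 1 ∉ c.touched := by
    refine hnot _ hw.1 ?_ (shift 1 (by decide) r)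
    rcases hlr' with rfl | rfl
    · exact shift 1 (by decide) _
    · rw [add_assoc]; exact shift _ (by decide) _
  have r3 : r + 3 ∉ c.touched := by
    refine hnot _ hw.2.1 ?_ (shift 3 (by decide) r)
    rcases hlr' with rfl | rfl
    · exact shift 3 (by decide) _
    · rw [add_assoc]; exact shift _ (by decide) _
  have l1 : l - 1 ∉ c.touched := by
    refine hnot _ hw.2.2.1 ?_ ?_
    · rw [sub_eq_add_neg]; exact shift _ (by decide) _
    · rcases hlr' with rfl | rfl
      · rw [sub_eq_add_neg]; exact shift _ (by decide) _
      · intro h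
        have : (2 : ZMod 235) = 0 := by linear_combination -h
        exact absurd this (by decide)
  have l3 : l - 3 ∉ c.touched := by
    refine hnot _ hw.2.2.2 ?_ ?_
    · rw [sub_eq_add_neg]; exact shift _ (by decide) _
    · rcases hlr' with rfl | rfl
      · rw [sub_eq_add_neg]; exact shift _ (by decide) _
      · intro h
        have : (4 : ZMod 235) = 0 := by linear_combination -h
        exact absurd this (by decide)
  have hp : ∃ p, p ∈ c.single ∧ p ∈ window k 4 ∧ (p = r + 1 ∨ p = r + 3) := by
    by_cases h : c.Paired (r + 1)
    · refine ⟨r + 3, mem_single r3 ?_ ?_, hw.2.1, Or.inr rfl⟩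
      · intro h'
        obtain ⟨E, hE, e1, e2⟩ := h.exists
        obtain ⟨F, hF, f1, f2⟩ := h'.exists
        rw [show r + 1 + 1 = r + 2 by ring] at e2
        rw [show r + 3 + 1 = r + 4 by ring] at f2
        exact c.right Q hQ r hr E hE F hF e1 e2 f1 f2
      · have := h.not_succ
        rwa [show r + 3 - 1 = r + 1 + 1 by ring]
    · refine ⟨r + 1, mem_single r1 h ?_, hw.1, Or.inl rfl⟩
      rw [add_sub_cancel_right]
      exact fun h' => h'.1 hrt
  have hq : ∃ p, p ∈ c.single ∧ p ∈ window k 4 ∧ (p = l - 1 ∨ p = l - 3) := by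
    by_cases h : c.Paired (l - 2)
    · refine ⟨l - 3, mem_single l3 ?_ ?_, hw.2.2.2, Or.inr rfl⟩
      · intro h'
        have := h'.not_succ
        rw [show l - 3 + 1 = l - 2 by ring] at this
        exact this h
      · intro h'
        obtain ⟨E, hE, e1, e2⟩ := h.exists
        obtain ⟨F, hF, f1, f2⟩ := h'.exists
        rw [show l - 2 + 1 = l - 1 by ring] at e2
        rw [show l - 3 - 1 = l - 4 by ring] at f1
        rw [show l - 3 - 1 + 1 = l - 3 by ring] at f2
        exact c.left Q hQ l hl E hE F hF e1 e2 f1 f2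
    · refine ⟨l - 1, mem_single l1 ?_ ?_, hw.2.2.1, Or.inl rfl⟩
      · intro h'
        have := h'.2.1
        rw [sub_add_cancel] at this
        exact this hlt
      · rwa [show l - 1 - 1 = l - 2 by ring]
  obtain ⟨p, hps, hpw, hp⟩ := hp
  obtain ⟨q, hqs, hqw, hq⟩ := hq
  have hpq : p ≠ q := by
    intro h
    have : ∃ d : ZMod 235, d = 0 ∧ (d = 2 ∨ d = 3 ∨ d = 4 ∨ d = 5 ∨ d = 6 ∨ d = 7) := by
      refine ⟨p - q, by rw [h, sub_self], ?_⟩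
      rcases hp with rfl | rfl <;> rcases hq with rfl | rfl <;> rcases hlr' with rfl | rfl <;>
        ring_nf <;> decide
    obtain ⟨d, rfl, hd⟩ := this
    rcases hd with hd | hd | hd | hd | hd | hd <;> exact absurd hd (by decide)
  have : ({p, q} : Finset (ZMod 235)) ⊆ c.single ∩ window k 4 := by
    intro m hm
    rw [Finset.mem_insert, Finset.mem_singleton] at hm
    rcases hm with h | h
    · rw [h]; exact Finset.mem_inter.2 ⟨hps, hpw⟩
    · rw [h]; exact Finset.mem_inter.2 ⟨hqs, hqw⟩
  rw [← Finset.card_pair hpq]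
  exact Finset.card_le_card this

/-- This finite check places every edge meeting the enlarged interval between the two contact
vertices within reach of `squeeze`. The extra −1 accounts for the edge to the left of the first
vertex. -/
theorem edgeOffset_mul_le : ∀ i ∈ Finset.Icc (-9 : ℤ) 9,
    ∀ j ∈ Finset.Icc (min 0 i - (if |i| ≤ 2 then 4 else 2) - 1) (max 0 i + if |i| ≤ 2 then 4 else 2),
      edgeOffset j * edgeOffset (j - i) ≤ 36 := by
  decide

-- Near a close inner and outer contact disk no pairs survive, so every untouched vertex there is
-- single. The two disks touch at most 4 vertices, and the pair-free interval has at least 8.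
open Classical in
theorem card_double_window {D B : ι} (hD : D ∈ c.inner) (hB : B ∈ c.outer) {k : ZMod 235} {i : ℤ}
    (hk : c.tch D k) (hi : |i| ≤ 9) (hki : c.tch B (k + i))
    (hfar : ∀ C, c.IsContact C → ∀ e : ℤ, |e| ≤ 13 → c.tch C (k + e) → C = D ∨ C = B) :
    (c.touched ∩ window k 13).card ≤ (c.single ∩ window k 13).card := by
  obtain ⟨l, r, -, -, -, hall⟩ := exists_ends (Or.inr hD) hk
  obtain ⟨l', r', -, -, -, hall'⟩ := exists_ends (Or.inl hB) hki
  have h1 : c.touched ∩ window k 13 ⊆ {l, r} ∪ {l', r'} := by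
    intro m hm
    rw [Finset.mem_inter, mem_window, mem_touched] at hm
    obtain ⟨⟨C, hC, hCm⟩, e, he, rfl⟩ := hm
    rcases hfar C hC e he hCm with rfl | rfl
    · apply Finset.mem_union_left
      simpa using hall _ hCm
    · apply Finset.mem_union_right
      simpa using hall' _ hCm
  have h2 : (c.touched ∩ window k 13).card ≤ 4 := by
    refine (Finset.card_le_card h1).trans ((Finset.card_union_le _ _).trans ?_)
    have a := Finset.card_le_two (a := l) (b := r)
    have b := Finset.card_le_two (a := l') (b := r')
    omega
  have hi' := abs_le.1 hi
  -- The interval has |i| + 2w + 1 vertices; a short distance |i| needs the wider margin to reach 8,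
  -- and `squeeze` still covers it.
  set w : ℤ := if |i| ≤ 2 then 4 else 2 with hw
  have hw1 : (3 : ℤ) ≤ |i| ∧ w = 2 ∨ |i| ≤ 2 ∧ w = 4 := by
    rw [hw]; split_ifs with h
    · exact Or.inr ⟨h, rfl⟩
    · exact Or.inl ⟨by omega, rfl⟩
  have hoff := edgeOffset_mul_le i (Finset.mem_Icc.2 hi')
  rw [← hw] at hoff
  have hnp : ∀ j ∈ Finset.Icc (min 0 i - w - 1) (max 0 i + w), ¬ c.Paired (k + (j : ℤ)) := by
    intro j hj hp
    obtain ⟨E, hE, e1, e2⟩ := hp.exists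
    exact c.squeeze D hD B hB k i j hk hki (hoff j hj) E hE e1 e2
  let U : Finset (ZMod 235) := (Finset.Icc (min 0 i - w) (max 0 i + w)).image fun j : ℤ => k + (j : ZMod 235)
  have hU : U ⊆ (c.touched ∩ window k 13) ∪ (c.single ∩ window k 13) := by
    intro m hm
    obtain ⟨j, hj, rfl⟩ := Finset.mem_image.1 hm
    rw [Finset.mem_Icc] at hj
    have hjw : k + (j : ZMod 235) ∈ window k 13 :=
      mem_window.2 ⟨j, by rw [abs_le]; rcases abs_cases i with h | h <;> omega, rfl⟩
    rw [← Finset.union_inter_distrib_right, Finset.mem_inter, Finset.mem_union]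
    refine ⟨?_, hjw⟩
    by_cases ht : k + (j : ZMod 235) ∈ c.touched
    · exact Or.inl ht
    · refine Or.inr (mem_single ht (hnp j (Finset.mem_Icc.2 ⟨by omega, by omega⟩)) ?_)
      have := hnp (j - 1) (Finset.mem_Icc.2 ⟨by omega, by omega⟩)
      rwa [show k + (j : ZMod 235) - 1 = k + ((j - 1 : ℤ) : ZMod 235) by push_cast; ring]
  have hUc : 8 ≤ U.card := by
    rw [Finset.card_image_of_injOn, Int.card_Icc]
    · rcases abs_cases i with h | h <;> omega
    · intro a ha b hb hab
      rw [Finset.coe_Icc, Set.mem_Icc] at ha hb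
      have hab' : ((a : ℤ) : ZMod 235) = (b : ℤ) := by simpa using hab
      rw [ZMod.intCast_eq_intCast_iff_dvd_sub] at hab'
      obtain ⟨q, hq⟩ := hab'
      rcases abs_cases i with h | h <;> omega
  have := (Finset.card_le_card hU).trans (Finset.card_union_le _ _)
  omega

theorem exists_near {Q : ι} (hQ : c.IsContact Q) {k l : ZMod 235} (hk : c.tch Q k)
    (hl : c.tch Q l) : ∃ e : ℤ, |e| ≤ 1 ∧ l = k + e := by
  rcases c.adjacent Q (by rcases hQ with h | h <;> simp [h]) k l hk hl with e | e | e
  · exact ⟨0, by decide, by simp [e]⟩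
  · exact ⟨1, by decide, by simp [e]⟩
  · exact ⟨-1, by decide, by simp [e]⟩

-- The inequality is checked in disjoint windows that cover all touched vertices: radius 4 around an
-- isolated contact disk, and radius 13 around the inner one if an outer one comes within 9 steps.
-- Uniqueness of the inner disk and the mutual distance of the outer ones leave at most one such
-- conflict.
open Classical in
theorem card_touched_le_card_single : c.touched.card ≤ c.single.card := by
  choose! κ hκ using c.touches
  have hout : ∀ Q ∈ c.outer, c.tch Q (κ Q) := fun Q hQ => hκ Q (Or.inl hQ)
  have far : ∀ Q ∈ c.outer, ∀ Q' ∈ c.outer, ∀ (k l : ZMod 235) (e : ℤ), |e| ≤ 26 → c.tch Q k →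
      c.tch Q' l → l = k + e → Q' = Q := by
    intro Q hQ Q' hQ' k l e he h1 h2 h3
    by_contra hne
    subst h3
    exact c.outer_far Q hQ Q' hQ' (Ne.symm hne) k e he h1 h2
  by_cases hconf : ∃ D ∈ c.inner, ∃ B ∈ c.outer, ∃ (k : ZMod 235) (i : ℤ), |i| ≤ 9 ∧ c.tch D k ∧
      c.tch B (k + i)
  · obtain ⟨D, hD, B₀, hB₀, k, i, hi, hDk, hBk⟩ := hconf
    have hin : ∀ C, c.IsContact C → C ∈ c.outer ∨ C = D := by
      intro C hC
      rcases hC with h | h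
      · exact Or.inl h
      · exact Or.inr (c.inner_unique C h D hD)
    -- The window of `B₀` also serves `D`. The worst case for disjointness is 13 + 4 + 9 = 26, the
    -- range of `outer_far`.
    apply card_le_card_of_windows c.outer fun B => if B = B₀ then window k 13 else window (κ B) 4
    · have key : ∀ B ∈ c.outer, B ≠ B₀ → Disjoint (window k 13) (window (κ B) 4) := by
        intro B hB hne
        rw [Finset.disjoint_left]
        intro m h1 h2
        obtain ⟨e, he, rfl⟩ := mem_window.1 h1
        obtain ⟨e', he', h3⟩ := mem_window.1 h2
        refine hne (far B₀ hB₀ B hB (k + i) (κ B) (e - e' - i) ?_ hBk (hout B hB) ?_)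
        · rw [abs_le] at *; omega
        · push_cast; linear_combination -h3
      intro B hB B' hB' hne
      by_cases h1 : B = B₀ <;> by_cases h2 : B' = B₀
      · exact absurd (h1.trans h2.symm) hne
      · rw [if_pos h1, if_neg h2]; exact key B' hB' h2
      · rw [if_neg h1, if_pos h2]; exact (key B hB h1).symm
      · rw [if_neg h1, if_neg h2, Finset.disjoint_left]
        intro m h3 h4
        obtain ⟨e, he, rfl⟩ := mem_window.1 h3
        obtain ⟨e', he', h5⟩ := mem_window.1 h4
        refine hne (far B' hB' B hB (κ B') (κ B) (e' - e) ?_ (hout B' hB') (hout B hB) ?_)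
        · rw [abs_le] at *; omega
        · push_cast; linear_combination h5
    · intro m hm
      obtain ⟨C, hC, hCm⟩ := c.mem_touched.1 hm
      rw [Finset.mem_biUnion]
      rcases hin C hC with h | rfl
      · by_cases hCB : C = B₀
        · subst hCB
          obtain ⟨e, he, rfl⟩ := exists_near hC hBk hCm
          refine ⟨C, h, ?_⟩
          rw [if_pos rfl, mem_window]
          refine ⟨i + e, ?_, by push_cast; ring⟩
          rw [abs_le] at *; omega
        · obtain ⟨e, he, rfl⟩ := exists_near hC (hout C h) hCm
          refine ⟨C, h, ?_⟩
          rw [if_neg hCB, mem_window]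
          exact ⟨e, he.trans (by decide), rfl⟩
      · obtain ⟨e, he, rfl⟩ := exists_near hC hDk hCm
        refine ⟨B₀, hB₀, ?_⟩
        rw [if_pos rfl, mem_window]
        exact ⟨e, he.trans (by decide), rfl⟩
    · intro B hB
      by_cases h1 : B = B₀
      · simp only [if_pos h1]
        apply card_double_window hD hB₀ hDk hi hBk
        intro C hC e he hCe
        rcases hin C hC with h | h
        · right
          refine far B₀ hB₀ C h (k + i) _ (e - i) ?_ hBk hCe (by push_cast; ring)
          rw [abs_le] at *; omega
        · exact Or.inl h
      · simp only [if_neg h1]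
        apply card_window (Or.inl hB) (hout B hB)
        intro C hC e he hCe
        rcases hin C hC with h | rfl
        · exact far B hB C h _ _ e (he.trans (by decide)) (hout B hB) hCe rfl
        · exfalso
          obtain ⟨e', he', h3⟩ := exists_near hC hDk hCe
          refine h1 (far B₀ hB₀ B hB (k + i) (κ B) (e' - e - i) ?_ hBk (hout B hB) ?_)
          · rw [abs_le] at *; omega
          · push_cast; linear_combination h3
  · push Not at hconf
    have hcon : ∀ C, c.IsContact C → ∀ C', c.IsContact C' → ∀ (k l : ZMod 235) (e : ℤ), |e| ≤ 9 →
        c.tch C k → c.tch C' l → l = k + e → C' = C := by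
      intro C hC C' hC' k l e he h1 h2 h3
      rcases hC with h | h <;> rcases hC' with h' | h'
      · exact far C h C' h' k l e (he.trans (by decide)) h1 h2 h3
      · refine absurd ?_ (hconf C' h' C h l (-e) (by rwa [abs_neg]) h2)
        rw [h3]; push_cast
        rwa [add_neg_cancel_right]
      · subst h3; exact absurd h2 (hconf C h C' h' k e he h1)
      · exact c.inner_unique C' h' C h
    apply card_le_card_of_windows (c.outer ∪ c.inner) fun B => window (κ B) 4
    · intro B hB B' hB' hne
      rw [Finset.mem_union] at hB hB'
      rw [Finset.disjoint_left]
      intro m h3 h4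
      obtain ⟨e, he, rfl⟩ := mem_window.1 h3
      obtain ⟨e', he', h5⟩ := mem_window.1 h4
      refine hne (hcon B' hB' B hB (κ B') (κ B) (e' - e) ?_ (hκ B' hB') (hκ B hB) ?_)
      · rw [abs_le] at *; omega
      · push_cast; linear_combination h5
    · intro m hm
      obtain ⟨C, hC, hCm⟩ := c.mem_touched.1 hm
      obtain ⟨e, he, rfl⟩ := exists_near hC (hκ C hC) hCm
      exact Finset.mem_biUnion.2 ⟨C, Finset.mem_union.2 hC,
        mem_window.2 ⟨e, he.trans (by decide), rfl⟩⟩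
    · intro B hB
      rw [Finset.mem_union] at hB
      apply card_window hB (hκ B hB)
      intro C hC e he hCe
      exact hcon B hB C hC _ _ e (he.trans (by decide)) (hκ B hB) hCe rfl

/-- Twice the number of remaining disks is at least 235, and parity rounds up. -/
theorem card_rest : 118 ≤ c.rest.card := by
  classical
  have h1 := card_compl_touched_add_card_single (c := c)
  have h2 := card_touched_le_card_single (c := c)
  have h3 := Finset.card_add_card_compl c.touched
  rw [ZMod.card] at h3
  omega

end ContactPattern

/-! ### The contact pattern of a separated family of disks. -/

namespace NormDisk

variable {ι : Type*} [Fintype ι] {N : ι → NormDisk}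

theorem touch_val_iff (A : NormDisk) (l : ℤ) :
    A.Touch (((l : ZMod 235).val : ℕ) : ℤ) ↔ A.Touch l := by
  rw [ZMod.val_intCast]
  conv_rhs => rw [← Int.emod_add_mul_ediv l 235]
  exact (touch_add_period _).symm

theorem Touch.not_add_two {A : NormDisk} {k : ℤ} (h : A.Touch k) : ¬ A.Touch (k + 2) := by
  intro h'
  have := h.adjacent h' (by norm_num) (by norm_num)
  omega

theorem Touch.adjacent_zmod {A : NormDisk} {k l : ℤ} (h : A.Touch k) (h' : A.Touch l) :
    (l : ZMod 235) = k ∨ (l : ZMod 235) = k + 1 ∨ (k : ZMod 235) = l + 1 := by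
  have e : l = (k + (l - k) % 235) + 235 * ((l - k) / 235) := by omega
  rw [e, touch_add_period] at h'
  have hz : (l : ZMod 235) = k + (((l - k) % 235 : ℤ) : ZMod 235) := by
    conv_lhs => rw [e]
    push_cast
    have : (235 : ZMod 235) = 0 := by decide
    rw [this]; ring
  rcases h.adjacent h' (by omega) (by omega) with e | e | e <;> rw [e] at hz
  · left; rw [hz]; simp
  · right; left; rw [hz]; simp
  · right; right; rw [hz]
    have : (235 : ZMod 235) = 0 := by decide
    push_cast
    linear_combination -this

theorem inner_ratio {A : NormDisk} (h : A.a = -A.b) : A.a ≤ 1.002 * -A.b := by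
  have := A.a_nonneg
  linarith

theorem no_two_pairs {A E F : NormDisk} {k l i : ℤ} (hA : A.Touch k)
    (hc : A.a - A.b ≤ 0.001 ∨ A.a = -A.b) (hAE : A.Sep E) (hAF : A.Sep F) (hsep : E.Sep F)
    (hE : E.Touch l) (hE' : E.Touch (l + 1)) (hF : F.Touch (l + i)) (hF' : F.Touch (l + i + 1))
    (hj : edgeOffset (l - k) * edgeOffset (l + i - k) * |i| ≤ 16) (hi : i ≠ 0) : False := by
  rcases hc with hc | hc
  · exact no_two_pairs_outer hA hA (hA.large hc).1 hAE hAF hsep hE hE' hF hF' hj hi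
  · exact no_two_pairs_inner hA hA (inner_ratio hc) hAE hAF hsep hE hE' hF hF' hj hi

open Classical in
/-- Among separated disks that cover the vertices of the regular 235-gon, one of which touches the
centre, at least 118 further small disks touch vertices. -/
theorem card_small (hsep : ∀ Q Q', Q ≠ Q' → (N Q).Sep (N Q')) (large : ι → Prop)
    (hlarge : ∀ Q, large Q → (N Q).a - (N Q).b ≤ 0.001) (D : ι) (hD : (N D).a = -(N D).b)
    (cover : ∀ k : ℤ, ∃ Q, (N Q).Touch k) :
    118 ≤ (Finset.univ.filter fun Q => ¬ large Q ∧ Q ≠ D ∧ ∃ k, (N Q).Touch k).card := by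
  have lift : ∀ k : ZMod 235, ∃ k₀ : ℤ, (k₀ : ZMod 235) = k := ZMod.intCast_surjective
  let outer := Finset.univ.filter fun Q => large Q ∧ ∃ k, (N Q).Touch k
  let inner := Finset.univ.filter fun Q => Q = D ∧ ∃ k, (N Q).Touch k
  let rest := Finset.univ.filter fun Q => ¬ large Q ∧ Q ≠ D ∧ ∃ k, (N Q).Touch k
  let tch : ι → ZMod 235 → Prop := fun Q k => (N Q).Touch (k.val : ℤ)
  have htch : ∀ Q (l : ℤ), tch Q (l : ZMod 235) ↔ (N Q).Touch l := fun Q l => touch_val_iff _ l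
  have mo : ∀ Q, Q ∈ outer ↔ large Q ∧ ∃ k, (N Q).Touch k := fun Q => by simp [outer]
  have mi : ∀ Q, Q ∈ inner ↔ Q = D ∧ ∃ k, (N Q).Touch k := fun Q => by simp [inner]
  have mr : ∀ Q, Q ∈ rest ↔ ¬ large Q ∧ Q ≠ D ∧ ∃ k, (N Q).Touch k := fun Q => by simp [rest]
  have hcontact : ∀ Q, Q ∈ outer ∨ Q ∈ inner → (N Q).a - (N Q).b ≤ 0.001 ∨ (N Q).a = -(N Q).b := by
    rintro Q (h | h)
    · exact Or.inl (hlarge Q ((mo Q).1 h).1)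
    · right; rw [((mi Q).1 h).1]; exact hD
  have hne : ∀ Q, Q ∈ outer ∨ Q ∈ inner → ∀ E ∈ rest, Q ≠ E := by
    rintro Q h E hE rfl
    obtain ⟨h1, h2, -⟩ := (mr Q).1 hE
    rcases h with h | h
    · exact h1 ((mo Q).1 h).1
    · exact h2 ((mi Q).1 h).1
  choose pick hpick using fun k : ZMod 235 => cover (k.val : ℤ)
  let c : ContactPattern ι :=
    { outer := outer
      inner := inner
      rest := rest
      tch := tch
      pick := pick
      inner_unique := fun Q hQ Q' hQ' => ((mi Q).1 hQ).1.trans ((mi Q').1 hQ').1.symm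
      touches := by
        intro Q hQ
        obtain ⟨k, hk⟩ : ∃ k, (N Q).Touch k := hQ.elim (fun h => ((mo Q).1 h).2)
          (fun h => ((mi Q).1 h).2)
        exact ⟨k, (htch Q k).2 hk⟩
      adjacent := by
        intro Q _ k l hk hl
        obtain ⟨k, rfl⟩ := lift k
        obtain ⟨l, rfl⟩ := lift l
        exact ((htch Q k).1 hk).adjacent_zmod ((htch Q l).1 hl)
      pick_spec := by
        intro k hk
        refine ⟨(mr _).2 ⟨fun h => ?_, fun h => ?_, _, hpick k⟩, hpick k⟩
        · exact hk _ (Or.inl ((mo _).2 ⟨h, _, hpick k⟩)) (hpick k)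
        · exact hk _ (Or.inr ((mi _).2 ⟨h, _, hpick k⟩)) (hpick k)
      right := by
        intro Q hQ k hk E hE F hF e1 e2 f1 f2
        obtain ⟨k, rfl⟩ := lift k
        rw [htch] at hk
        have e1' := (htch E (k + 1)).1 (by push_cast; exact e1)
        have e2' := (htch E (k + 2)).1 (by push_cast; exact e2)
        have f1' := (htch F (k + 3)).1 (by push_cast; exact f1)
        have f2' := (htch F (k + 4)).1 (by push_cast; exact f2)
        rw [show k + 2 = k + 1 + 1 by ring] at e2'
        rw [show k + 3 = k + 1 + 2 by ring] at f1'
        rw [show k + 4 = k + 1 + 2 + 1 by ring] at f2'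
        have hEF : E ≠ F := by rintro rfl; exact e1'.not_add_two f1'
        refine no_two_pairs hk (hcontact Q hQ) (hsep _ _ (hne Q hQ E hE))
          (hsep _ _ (hne Q hQ F hF)) (hsep _ _ hEF) e1' e2' f1' f2' ?_ (by norm_num)
        -- The two edges have offsets 2 and 4 and lie 2 steps apart, so the product is exactly the
        -- permitted 16.
        rw [show k + 1 - k = 1 by ring, show k + 1 + 2 - k = 3 by ring]
        decide
      left := by
        intro Q hQ k hk E hE F hF e1 e2 f1 f2
        obtain ⟨k, rfl⟩ := lift k
        rw [htch] at hk
        have e1' := (htch E (k - 2)).1 (by push_cast; exact e1)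
        have e2' := (htch E (k - 1)).1 (by push_cast; exact e2)
        have f1' := (htch F (k - 4)).1 (by push_cast; exact f1)
        have f2' := (htch F (k - 3)).1 (by push_cast; exact f2)
        have hEF : E ≠ F := by
          rintro rfl
          exact f1'.not_add_two (by rwa [show k - 4 + 2 = k - 2 by ring])
        rw [show k - 1 = k - 2 + 1 by ring] at e2'
        rw [show k - 4 = k - 2 + -2 by ring] at f1'
        rw [show k - 3 = k - 2 + -2 + 1 by ring] at f2'
        refine no_two_pairs hk (hcontact Q hQ) (hsep _ _ (hne Q hQ E hE))
          (hsep _ _ (hne Q hQ F hF)) (hsep _ _ hEF) e1' e2' f1' f2' ?_ (by norm_num)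
        rw [show k - 2 - k = -2 by ring, show k - 2 + -2 - k = -4 by ring]
        decide
      outer_far := by
        intro Q hQ Q' hQ' hne k e he hk hk'
        obtain ⟨k, rfl⟩ := lift k
        rw [htch] at hk
        have hk2 := (htch Q' (k + e)).1 (by push_cast; exact hk')
        exact no_two_large hk hk2 (hlarge Q ((mo Q).1 hQ).1) (hlarge Q' ((mo Q').1 hQ').1) he
          (hsep _ _ hne)
      squeeze := by
        intro D' hD' B hB k i j hk hki hij E hE e1 e2
        obtain ⟨k, rfl⟩ := lift k
        rw [htch] at hk
        have b1 := (htch B (k + i)).1 (by push_cast; exact hki)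
        have e1' := (htch E (k + j)).1 (by push_cast; exact e1)
        have e2' := (htch E (k + j + 1)).1 (by push_cast; exact e2)
        have hin : (N D').a = -(N D').b := by rw [((mi D').1 hD').1]; exact hD
        refine no_pair_between hk (inner_ratio hin) b1 (b1.large (hlarge B ((mo B).1 hB).1)).1
          (hsep _ _ (hne _ (Or.inr hD') E hE)) (hsep _ _ (hne _ (Or.inl hB) E hE)) e1' e2' ?_
        rwa [show k + j - k = j by ring, show k + j - (k + i) = j - i by ring] }
  exact c.card_rest

end NormDisk

/-! ### Wheels, their union, and the final bound. -/

theorem vertex_add_period (z : Plane) (k m : ℤ) : vertex z (k + 235 * m) = vertex z k := by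
  have : 2 * halfStep * ((k + 235 * m : ℤ) : ℝ) = 2 * halfStep * k + m * (2 * Real.pi) := by
    unfold halfStep; push_cast; ring
  unfold vertex
  rw [this, Real.cos_add_int_mul_two_pi, Real.sin_add_int_mul_two_pi]

open Classical in
/-- A regular 235-gon with circumradius `1` together with its centre. -/
noncomputable def wheel (z : Plane) : Finset Plane :=
  insert z ((Finset.range 235).image fun k : ℕ => vertex z k)

theorem center_mem_wheel (z : Plane) : z ∈ wheel z := Finset.mem_insert_self _ _

theorem vertex_mem_wheel (z : Plane) (k : ℤ) : vertex z k ∈ wheel z := by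
  apply Finset.mem_insert_of_mem
  rw [Finset.mem_image]
  refine ⟨(k % 235).toNat, by rw [Finset.mem_range]; omega, ?_⟩
  have e : k = (((k % 235).toNat : ℕ) : ℤ) + 235 * (k / 235) := by omega
  conv_rhs => rw [e]
  exact (vertex_add_period _ _ _).symm

theorem card_wheel_le (z : Plane) : (wheel z).card ≤ 236 := by
  classical
  refine (Finset.card_insert_le _ _).trans ?_
  have := Finset.card_image_le (s := Finset.range 235) (f := fun k : ℕ => vertex z k)
  rw [Finset.card_range] at this
  omega

theorem dist_le_one_of_mem_wheel {z p : Plane} (h : p ∈ wheel z) : dist p z ≤ 1 := by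
  rcases Finset.mem_insert.1 h with rfl | h
  · simp
  · obtain ⟨k, -, rfl⟩ := Finset.mem_image.1 h
    exact (dist_vertex z k).le

theorem IsDisjointBubbleSet.mono {P P' : Finset Plane} {𝒬 : Finset Disk} (h : P ⊆ P')
    (h𝒬 : IsDisjointBubbleSet P' 𝒬) : IsDisjointBubbleSet P 𝒬 where
  empty Q hQ p hp := h𝒬.empty Q hQ p (h hp)
  disjoint := h𝒬.disjoint
  supported p hp := h𝒬.supported p (h hp)

open Classical in
/-- A disjoint bubble set for a wheel contains at least 119 small disks touching it. -/
theorem IsDisjointBubbleSet.card_wheel {z : Plane} {𝒬 : Finset Disk}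
    (h : IsDisjointBubbleSet (wheel z) 𝒬) :
    119 ≤ (𝒬.filter fun Q => Q.radius < 1000 ∧ ∃ p ∈ wheel z, p ∈ Q.boundary).card := by
  have hz : ∀ Q : 𝒬, z ∉ Q.1.interior := fun Q => h.empty Q.1 Q.2 z (center_mem_wheel z)
  have hv : ∀ Q : 𝒬, ∀ k, vertex z k ∉ Q.1.interior := fun Q k =>
    h.empty Q.1 Q.2 _ (vertex_mem_wheel z k)
  let N : 𝒬 → NormDisk := fun Q => Q.1.toNormDisk z (hz Q) (hv Q)
  obtain ⟨D, hD, hDz⟩ := h.supported z (center_mem_wheel z)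
  have hDN : (N ⟨D, hD⟩).a = -(N ⟨D, hD⟩).b := Disk.a_eq_neg_b_toNormDisk _ _ hDz
  have main := NormDisk.card_small (N := N)
    (fun Q Q' hne => Disk.sep_toNormDisk _ _ _ _
      (h.disjoint Q.1 Q.2 Q'.1 Q'.2 fun e => hne (Subtype.ext e)))
    (fun Q => 1000 ≤ Q.1.radius)
    (fun Q hQ => by
      have e : (N Q).a - (N Q).b = 1 / Q.1.radius := Disk.a_sub_b_toNormDisk _ _
      rw [e, div_le_iff₀ Q.1.radius_pos]
      linarith)
    ⟨D, hD⟩ hDN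
    (fun k => by
      obtain ⟨Q, hQ, hk⟩ := h.supported _ (vertex_mem_wheel z k)
      exact ⟨⟨Q, hQ⟩, (Disk.touch_toNormDisk_iff _ _ k).2 hk⟩)
  -- Here 1/r = a − b = 2a ≥ 0.2, so r ≤ 5: the disk at the centre is itself small and is the 119th
  -- disk.
  have hDr : D.radius < 1000 := by
    have e : (N ⟨D, hD⟩).a - (N ⟨D, hD⟩).b = 1 / D.radius := Disk.a_sub_b_toNormDisk _ _
    have e2 := NormDisk.center_small hDN
    have e3 : 0.2 ≤ 1 / D.radius := by linarith
    rw [le_div_iff₀ D.radius_pos] at e3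
    linarith
  set R := Finset.univ.filter fun Q : 𝒬 => ¬ 1000 ≤ Q.1.radius ∧ Q ≠ ⟨D, hD⟩ ∧ ∃ k, (N Q).Touch k
  have hDR : D ∉ R.map (Function.Embedding.subtype _) := by
    intro hmem
    obtain ⟨Q, hQ, hQD⟩ := Finset.mem_map.1 hmem
    exact (Finset.mem_filter.1 hQ).2.2.1 (Subtype.ext hQD)
  have hsub : insert D (R.map (Function.Embedding.subtype _)) ⊆
      𝒬.filter fun Q => Q.radius < 1000 ∧ ∃ p ∈ wheel z, p ∈ Q.boundary := by
    intro Q hQ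
    rcases Finset.mem_insert.1 hQ with rfl | hQ
    · exact Finset.mem_filter.2 ⟨hD, hDr, z, center_mem_wheel z, hDz⟩
    · obtain ⟨Q, hQR, rfl⟩ := Finset.mem_map.1 hQ
      obtain ⟨-, h1, -, k, hk⟩ := Finset.mem_filter.1 hQR
      exact Finset.mem_filter.2 ⟨Q.2, not_le.1 h1, vertex z k, vertex_mem_wheel z k,
        (Disk.touch_toNormDisk_iff _ _ k).1 hk⟩
  have := Finset.card_le_card hsub
  rw [Finset.card_insert_of_notMem hDR, Finset.card_map] at this
  have hR : 118 ≤ R.card := by convert main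
  omega

/-- Centres of wheels far apart from each other. -/
noncomputable def wheelCenter (q : ℕ) : Plane := EuclideanSpace.single 0 (3000 * q : ℝ)

theorem dist_wheelCenter {q q' : ℕ} (h : q ≠ q') : 3000 ≤ dist (wheelCenter q) (wheelCenter q') := by
  rw [wheelCenter, wheelCenter, PiLp.dist_single_same, Real.dist_eq, ← mul_sub, abs_mul]
  have : (1 : ℝ) ≤ |(q : ℝ) - q'| := by
    have h1 : (1 : ℤ) ≤ |(q : ℤ) - q'| := Int.one_le_abs (sub_ne_zero.2 (by exact_mod_cast h))
    exact_mod_cast h1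
  rw [abs_of_pos (by norm_num : (0 : ℝ) < 3000)]
  linarith

open Classical in
/-- The union of `m` wheels far apart from each other. -/
noncomputable def wheels (m : ℕ) : Finset Plane :=
  (Finset.range m).biUnion fun q => wheel (wheelCenter q)

theorem card_wheels_le (m : ℕ) : (wheels m).card ≤ m * 236 := by
  classical
  refine Finset.card_biUnion_le.trans ((Finset.sum_le_card_nsmul _ _ _ fun q _ =>
    card_wheel_le (wheelCenter q)).trans ?_)
  simp

/-- A disk of diameter below 2000 cannot touch two wheels of radius 1 with centres at least 3000
apart, so the small disks of different wheels are distinct. -/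
theorem IsDisjointBubbleSet.card_wheels {m : ℕ} {𝒬 : Finset Disk}
    (h : IsDisjointBubbleSet (wheels m) 𝒬) : m * 119 ≤ 𝒬.card := by
  classical
  let F : ℕ → Finset Disk := fun q =>
    𝒬.filter fun Q => Q.radius < 1000 ∧ ∃ p ∈ wheel (wheelCenter q), p ∈ Q.boundary
  have hdisj : ∀ q ∈ Finset.range m, ∀ q' ∈ Finset.range m, q ≠ q' → Disjoint (F q) (F q') := by
    intro q _ q' _ hne
    rw [Finset.disjoint_left]
    intro Q h1 h2
    obtain ⟨-, hr, p, hp, hpQ⟩ := Finset.mem_filter.1 h1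
    obtain ⟨-, -, p', hp', hpQ'⟩ := Finset.mem_filter.1 h2
    have d1 := dist_le_one_of_mem_wheel hp
    have d2 := dist_le_one_of_mem_wheel hp'
    have d3 := dist_wheelCenter hne
    have d4 : dist p Q.center = Q.radius := hpQ
    have d5 : dist p' Q.center = Q.radius := hpQ'
    have t1 := dist_triangle_left (wheelCenter q) (wheelCenter q') p
    have t2 := dist_triangle p p' (wheelCenter q')
    have t3 := dist_triangle_right p p' Q.center
    linarith
  calc m * 119 = ∑ _q ∈ Finset.range m, 119 := by simp
    _ ≤ ∑ q ∈ Finset.range m, (F q).card := by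
        apply Finset.sum_le_sum
        intro q hq
        exact (h.mono (Finset.subset_biUnion_of_mem (fun q => wheel (wheelCenter q)) hq)).card_wheel
    _ = ((Finset.range m).biUnion F).card := (Finset.card_biUnion hdisj).symm
    _ ≤ 𝒬.card := by
        apply Finset.card_le_card
        intro Q hQ
        obtain ⟨q, -, hq⟩ := Finset.mem_biUnion.1 hQ
        exact (Finset.mem_filter.1 hq).1

/-- The wheels are padded to `n` points arbitrarily; a bubble set for the larger set is still one
for the wheels. -/
theorem mul_le_disjointBubbleNumber {m n : ℕ} (h : m * 236 ≤ n) :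
    m * 119 ≤ disjointBubbleNumber n := by
  obtain ⟨P, hP, hPn⟩ := Infinite.exists_superset_card_eq (wheels m) n
    ((card_wheels_le m).trans h)
  have h1 : m * 119 ≤ disjointBubbleNumberOf P := by
    obtain ⟨𝒬₀, h₀, -⟩ := exists_isDisjointBubbleSet P
    obtain ⟨𝒬, h𝒬, hcard⟩ := Nat.sInf_mem (s := {m : ℕ | ∃ 𝒬 : Finset Disk,
      IsDisjointBubbleSet P 𝒬 ∧ 𝒬.card = m}) ⟨_, 𝒬₀, h₀, rfl⟩
    have := (h𝒬.mono hP).card_wheels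
    rw [hcard] at this
    exact this
  exact h1.trans (le_csSup (bddAbove_disjointBubbleNumberOf n) ⟨P, hPn, rfl⟩)

theorem theorem3 :
    ∃ C : ℝ, ∀ n : ℕ,
      (n : ℝ) / 2 + (n : ℝ) / 236 - C * Real.sqrt n ≤ (disjointBubbleNumber n : ℝ) := by
  -- Rounding `n` down to a multiple of 236 loses less than one wheel, that is 119 disks, and √n ≥ 1
  -- for positive `n`.
  refine ⟨119, fun n => ?_⟩
  rcases Nat.eq_zero_or_pos n with rfl | hn
  · simp
  · have h1 : n / 236 * 119 ≤ disjointBubbleNumber n :=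
      mul_le_disjointBubbleNumber (Nat.div_mul_le_self n 236)
    have h2 : ((n / 236 : ℕ) : ℝ) * 119 ≤ disjointBubbleNumber n := by exact_mod_cast h1
    have h3 : (n : ℝ) < 236 * ((n / 236 : ℕ) : ℝ) + 236 := by
      exact_mod_cast (by omega : n < 236 * (n / 236) + 236)
    have h4 : (1 : ℝ) ≤ Real.sqrt n := by
      rw [Real.one_le_sqrt]
      exact_mod_cast hn
    linarith
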